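/- **Trigonometric $q$-KZ equation.** Let $n,k\ge 0$, let $q_1,q_2,z\in\mathbb{C}^\times$ with $|q_1|,|q_2|>1$, with fixed logarithms, let $\mu_1,\dots,\mu_n\in\mathbb{C}$ and $K_\alpha=q_1^{\mu_\alpha}$. Write $(y)_\infty=\prod_{d\ge0}(1-yq_2^{-d})$, $[u]=1-u$, $x_{ij}=x_i/x_j$, $[d\underline x]=\prod_i dx_i/(2\pi\mathrm{i}x_i)$. For a chamber (an ordering $w$ of $\{1,\dots,n\}$) and $\underline k=(k_1,\dots,k_n)\in\mathbb{Z}_{\ge0}^n$ with $\sum_\alpha k_\alpha=k$, let $c:\{1,\dots,k\}\to\{1,\dots,n\}$ be the colouring with $\#c^{-1}(\alpha)=k_\alpha$ that is weakly decreasing with respect to $w$ (the last operator of the chamber gets the first variables), and put $$\operatorname{Stab}_{w,\underline k}(\underline x,\underline a)=\operatorname*{Sym}_{\underline x}\Big[\prod_{i<j}\frac{[q_1x_{ji}]}{[x_{ji}]}\prod_{i=1}^k\Big(\prod_{\alpha<_wc(i)}[a_\alpha/x_i]\prod_{\alpha>_wc(i)}[K_\alpha a_\alpha/x_i]\Big)\Big],$$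 where $\operatorname{Sym}$ is the sum over all permutations of the variables. The trigonometric conformal block of $\mathrm{W}_{q_{1,2}}(A_1)$ in the chamber $w$ is the vector with components $$\Psi^{\underline k}_w(\underline a)=\frac1{k!}\exp\Big(\frac{\log z}{\log q_2^{-1}}\sum_\alpha\frac{\mu_\alpha}2\log a_\alpha\Big)\oint_\gamma[d\underline x]\prod_ix_i^{-\frac{\log z}{\log q_2^{-1}}}\prod_{i\ne j}\frac{(x_{ij})_\infty}{(q_1x_{ij})_\infty}\prod_{i,\alpha}\frac{(K_\alpha a_\alpha/x_i)_\infty}{(a_\alpha/x_i)_\infty}\,\frac{\operatorname{Stab}_{w,\underline k}(\underline x,\underline a)}{\prod_{i,\alpha}[K_\alpha a_\alpha/x_i]} .$$ Here $\gamma$ is any $k$-dimensional contour (a finite or infinite family of singular cubes in $(\mathbb{C}^\times)^k$, with a branch of $\log x_i$ along it) that almost everywhere avoids the divisors $x_i=q_2^ma_\alpha$, $x_i=q_2^mK_\alpha a_\alpha$ and, for $i\neq j$, $x_i=q_2^mx_j$, $x_i=q_2^mq_1x_j$ ($m\in\mathbb{Z}$). It is taken such that, at the two values of $\underline a$ in the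 equation below, for every chamber and every $\underline k$, the integrals of all summands of the symmetrized integrand converge and are invariant under $x_i\to q_2^{-1}x_i$ for the variables in any subset. For two operators $\alpha,\beta$ and $m\ge0$, let $S_{\alpha\beta}$ be the $(m+1)\times(m+1)$ matrix of two-point stable envelopes for the chamber $a_\alpha\succ a_\beta$, with entries $\operatorname{Stab}_{(j,m-j)}$ evaluated at the vacua $\underline x=(a_\alpha,a_\alpha q_1,\dots,a_\alpha q_1^{l-1},a_\beta,\dots,a_\beta q_1^{m-l-1})$, $0\le j,l\le m$; let $S_{\beta\alpha}$ be the matrix for the other chamber, with the same labelling of rows and columns. The trigonometric $R$-matrix is $R_{\beta,\alpha}(a_\beta/a_\alpha)=S_{\alpha\beta}S_{\beta\alpha}^{-1}$ (evaluated at $(a_\alpha,a_\beta)=(1,u)$, $u=a_\beta/a_\alpha$). It does not depend on $z$, and acts on vectors indexed by $\underline k$ through the entries $(k_\alpha,k_\beta)$, with $m=k_\alpha+k_\beta$ preserved. Let $h_\alpha$ be the weight operator of the $\alpha$-th operator, with eigenvalue $\frac{\mu_\alpha}2-k_\alpha$ on the component $\underline k$. Fix $\alpha$ and assume that $u\notin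 q_1^{\mathbb{Z}}\cup K_\alpha q_1^{\mathbb{Z}}$ for every argument $u$ of an $R$-matrix below. Then the block $\Psi=\Psi_{\mathscr{C}_{1\ldots n}}$ in the chamber $a_1\succ\dots\succ a_n$ satisfies $$\Psi\big|_{a_\alpha\to q_2^{-1}a_\alpha}=R_{\alpha+1,\alpha}(q_2a_{\alpha+1}/a_\alpha)\cdots R_{n,\alpha}(q_2a_n/a_\alpha)\,z^{h_\alpha}\,R_{1,\alpha}(a_1/a_\alpha)\cdots R_{\alpha-1,\alpha}(a_{\alpha-1}/a_\alpha)\,\Psi ,$$ where the shift means $\log a_\alpha\to\log a_\alpha+\log q_2^{-1}$ and $\gamma$ is the same on both sides. -/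

import Mathlib

open MeasureTheory

noncomputable section

namespace TrigQKZ

/-- The bracket `[u] = PE[u]⁻¹ = 1 - u`. -/
def br (u : ℂ) : ℂ := 1 - u

/-- The infinite `q`-shifted factorial `(y; q)_∞ = ∏_{d ≥ 0} (1 - y q^d)` (used for `|q| < 1`). -/
def qPoch (y q : ℂ) : ℂ := ∏' d : ℕ, (1 - y * q ^ d)

/-! ### Stable envelopes -/

section Stab

variable {n k : ℕ}

/-- A chamber `a_{w 0} ≻ a_{w 1} ≻ ⋯` is recorded by the permutation `w`, and `κ α` is the number
of screening currents attached to the `α`-th operator. The screening variables are distributed in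
consecutive blocks, the last operator of the chamber taking the first block. This is the number of
variables that precede the block of the operator in position `p`. -/
def blockStart (w : Equiv.Perm (Fin n)) (κ : Fin n → ℕ) (p : Fin n) : ℕ :=
  ∑ r ∈ Finset.Ioi p, κ (w r)

/-- The `i`-th variable is attached to the operator in position `p`, i.e. its colour `c(i)` is
`w p`. -/
def HasColor (w : Equiv.Perm (Fin n)) (κ : Fin n → ℕ) (i : Fin k) (p : Fin n) : Prop :=
  blockStart w κ p ≤ (i : ℕ) ∧ (i : ℕ) < blockStart w κ p + κ (w p)

open scoped Classical in
/-- The summand of the trigonometric stable envelope: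
`∏_{i<j} [t x_j/x_i]/[x_j/x_i] ∏_i (∏_{α before c(i)} [a_α/x_i] ∏_{α after c(i)} [K_α a_α/x_i])`. -/
def stabTerm (t : ℂ) (K a : Fin n → ℂ) (w : Equiv.Perm (Fin n)) (κ : Fin n → ℕ)
    (x : Fin k → ℂ) : ℂ :=
  (∏ i, ∏ j ∈ Finset.Ioi i, br (t * (x j / x i)) / br (x j / x i)) *
    ∏ i, ∏ p, if HasColor w κ i p then
      (∏ r ∈ Finset.Iio p, br (a (w r) / x i)) *
        ∏ r ∈ Finset.Ioi p, br (K (w r) * a (w r) / x i)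
      else 1

/-- The (off-shell) trigonometric stable envelope of the chamber `w`, without its symmetric
denominator `∏_{i,α} [K_α a_α/x_i]`: the symmetrization of `stabTerm` in the variables `x`. -/
def stab (t : ℂ) (K a : Fin n → ℂ) (w : Equiv.Perm (Fin n)) (κ : Fin n → ℕ)
    (x : Fin k → ℂ) : ℂ :=
  ∑ σ : Equiv.Perm (Fin k), stabTerm t K a w κ (x ∘ σ)

end Stab

/-! ### R-matrices -/

/-- The two-point vacuum `(l, m - l)`:
`x = (a_0, a_0 t, …, a_0 t^{l-1}, a_1, a_1 t, …, a_1 t^{m-l-1})`. -/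
def vacuum (t : ℂ) (a : Fin 2 → ℂ) (m l : ℕ) : Fin m → ℂ :=
  fun i => if (i : ℕ) < l then a 0 * t ^ (i : ℕ) else a 1 * t ^ ((i : ℕ) - l)

/-- The on-shell two-point stable envelope of the chamber `w` with `m` screening variables: the
rows are the configurations `(j, m - j)`, the columns the vacua `(l, m - l)`. -/
def stabMatrix (t : ℂ) (K a : Fin 2 → ℂ) (w : Equiv.Perm (Fin 2)) (m : ℕ) :
    Matrix (Fin (m + 1)) (Fin (m + 1)) ℂ :=
  Matrix.of fun j l => stab t K a w ![(j : ℕ), m - j] (vacuum t a m l)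

/-- The two-point trigonometric `R`-matrix of two operators with labels `Kα`, `Kβ` and ratio
`u = a_β/a_α` of spectral parameters, on the subspace with `m` screening variables: the stable
envelope of the chamber `a_α ≻ a_β` times the inverse of that of the chamber `a_β ≻ a_α`. -/
def Rmat (t Kα Kβ u : ℂ) (m : ℕ) : Matrix (Fin (m + 1)) (Fin (m + 1)) ℂ :=
  stabMatrix t ![Kα, Kβ] ![1, u] 1 m * (stabMatrix t ![Kα, Kβ] ![1, u] (Equiv.swap 0 1) m)⁻¹

/-- Vectors with components labelled by the configurations `κ = (κ_1, …, κ_n)`. -/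
abbrev Vec (n : ℕ) : Type := (Fin n → ℕ) → ℂ

/-- The `R`-matrix `R_{β,α}(u)` acting on the `α`-th and `β`-th entries of the configuration. -/
def Rop {n : ℕ} (t : ℂ) (K : Fin n → ℂ) (β α : Fin n) (u : ℂ) : Module.End ℂ (Vec n) where
  toFun v κ := ∑ l : Fin (κ α + κ β + 1),
    Rmat t (K α) (K β) u (κ α + κ β) ⟨κ α, by omega⟩ l *
      v (Function.update (Function.update κ α (l : ℕ)) β (κ α + κ β - l))
  map_add' v v' := by
    funext κ
    simp [mul_add, Finset.sum_add_distrib]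
  map_smul' c v := by
    funext κ
    simp only [Pi.smul_apply, smul_eq_mul, RingHom.id_apply, Finset.mul_sum]
    exact Finset.sum_congr rfl fun l _ => by ring

/-- The parameters, given by their logarithms: `q₁ = exp logq₁`, `q₂ = exp logq₂`, `z = exp logz`,
`K_α = q₁ ^ μ_α`. -/
structure Params (n : ℕ) where
  logq₁ : ℂ
  logq₂ : ℂ
  logz : ℂ
  μ : Fin n → ℂ

namespace Params

variable {n : ℕ} (P : Params n)

def q₁ : ℂ := Complex.exp P.logq₁

def q₂ : ℂ := Complex.exp P.logq₂

def K (α : Fin n) : ℂ := Complex.exp (P.μ α * P.logq₁)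

/-- `log z / log q₂⁻¹`. -/
def s : ℂ := P.logz / (-P.logq₂)

/-- The operator `z ^ h_α`, where the weight operator `h_α` is diagonal with eigenvalue
`μ_α / 2 - κ_α` on the component `κ`. -/
def zPowWeight (α : Fin n) : Module.End ℂ (Vec n) where
  toFun v κ := Complex.exp (P.logz * (P.μ α / 2 - κ α)) * v κ
  map_add' v v' := by
    funext κ
    simp [mul_add]
  map_smul' c v := by
    funext κ
    simp only [Pi.smul_apply, smul_eq_mul, RingHom.id_apply]
    ring

/-- The `R`-matrix `R_{β,α}(u)` for the parameters `P`. It does not involve `z`. -/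
def R (β α : Fin n) (u : ℂ) : Module.End ℂ (Vec n) := Rop P.q₁ P.K β α u

end Params

/-! ### Contours -/

/-- A `k`-dimensional contour in `(ℂˣ)^k`: a family of differentiable singular cubes, written in
the coordinates `lam_i = log x_i` so that the powers of `x_i` have a branch along it. -/
structure Contour (k : ℕ) where
  ι : Type
  cube : ι → (Fin k → ℝ) → (Fin k → ℂ)
  smooth : ∀ j, ContDiff ℝ 1 (cube j)

namespace Contour

variable {k : ℕ} (γ : Contour k)

/-- The pull-back of `f ∏_i dx_i / (2 π i x_i) = f ∏_i dlam_i / (2 π i)` by the `j`-th cube. -/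
def pullback (f : (Fin k → ℂ) → ℂ) (j : γ.ι) (t : Fin k → ℝ) : ℂ :=
  f (γ.cube j t) *
    (Matrix.det (Matrix.of fun i l : Fin k => fderiv ℝ (γ.cube j) t (Pi.single l 1) i) /
      (2 * Real.pi * Complex.I) ^ k)

/-- `∮_γ [dx] f`. -/
def integral (f : (Fin k → ℂ) → ℂ) : ℂ :=
  ∑' j, ∫ t in Set.Icc (0 : Fin k → ℝ) 1, γ.pullback f j t

/-- Convergence of `∮_γ [dx] f`. -/
def Converges (f : (Fin k → ℂ) → ℂ) : Prop :=
  (∀ j, IntegrableOn (γ.pullback f j) (Set.Icc 0 1)) ∧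
    Summable fun j => ∫ t in Set.Icc (0 : Fin k → ℝ) 1, γ.pullback f j t

end Contour

/-! ### The trigonometric conformal block -/

section Block

variable {n k : ℕ} (P : Params n)

/-- The spectral parameters `a_α = exp A_α`. -/
def spec (A : Fin n → ℂ) (α : Fin n) : ℂ := Complex.exp (A α)

/-- The screening variables `x_i = exp lam_i`. -/
def vars (lam : Fin k → ℂ) (i : Fin k) : ℂ := Complex.exp (lam i)

/-- The shift `a_α → q₂⁻¹ a_α`. -/
def shiftSpec (A : Fin n → ℂ) (α : Fin n) : Fin n → ℂ :=
  Function.update A α (A α - P.logq₂)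

/-- The shift `x_i → q₂⁻¹ x_i` of the variables with `i ∈ S`. -/
def shiftVars (S : Finset (Fin k)) (lam : Fin k → ℂ) : Fin k → ℂ :=
  fun i => if i ∈ S then lam i - P.logq₂ else lam i

/-- The principal part `∏_i x_i ^ (-log z / log q₂⁻¹)
∏_{i ≠ j} (x_i/x_j)_∞ / (q₁ x_i/x_j)_∞ ∏_{i,α} (K_α a_α/x_i)_∞ / (a_α/x_i)_∞`, where
`(y)_∞ = (y; q₂⁻¹)_∞`. -/
def principal (A : Fin n → ℂ) (lam : Fin k → ℂ) : ℂ :=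
  let x := vars lam
  let a := spec A
  Complex.exp (-P.s * ∑ i, lam i) *
    (∏ i, ∏ j ∈ Finset.univ.erase i,
      qPoch (x i / x j) P.q₂⁻¹ / qPoch (P.q₁ * (x i / x j)) P.q₂⁻¹) *
    ∏ i, ∏ α, qPoch (P.K α * a α / x i) P.q₂⁻¹ / qPoch (a α / x i) P.q₂⁻¹

/-- The symmetric denominator `∏_{i,α} [K_α a_α/x_i]` of the stable envelope. -/
def stabDenom (A : Fin n → ℂ) (lam : Fin k → ℂ) : ℂ :=
  ∏ i, ∏ α, br (P.K α * spec A α / vars lam i)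

/-- The component `κ` (with `∑ κ_α = k`) of the trigonometric conformal block in the chamber `w`;
the other components are zero. -/
def block (γ : Contour k) (w : Equiv.Perm (Fin n)) (A : Fin n → ℂ) : Vec n := fun κ =>
  if ∑ α, κ α = k then
    (1 / (k.factorial : ℂ)) * Complex.exp (P.s * ∑ α, P.μ α / 2 * A α) *
      γ.integral fun lam =>
        principal P A lam * (stab P.q₁ P.K (spec A) w κ (vars lam) / stabDenom P A lam)
  else 0

/-- The integrand of the block with the single summand of the symmetrization that belongs to the
permutation `σ` of the variables. -/
def summand (A : Fin n → ℂ) (w : Equiv.Perm (Fin n)) (κ : Fin n → ℕ) (σ : Equiv.Perm (Fin k))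
    (lam : Fin k → ℂ) : ℂ :=
  principal P A lam * (stabTerm P.q₁ P.K (spec A) w κ (vars lam ∘ σ) / stabDenom P A lam)

/-- The contour avoids (almost everywhere) the divisors `x_i = q₂^m a_α`, `x_i = q₂^m K_α a_α`,
`x_i = q₂^m x_j`, `x_i = q₂^m q₁ x_j`. -/
def AvoidsPoles (γ : Contour k) (A : Fin n → ℂ) : Prop :=
  ∀ c, ∀ᵐ t ∂(volume.restrict (Set.Icc (0 : Fin k → ℝ) 1)), ∀ m : ℤ,
    (∀ i α, vars (γ.cube c t) i ≠ P.q₂ ^ m * spec A α ∧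
      vars (γ.cube c t) i ≠ P.q₂ ^ m * (P.K α * spec A α)) ∧
    (∀ i j, i ≠ j → vars (γ.cube c t) i ≠ P.q₂ ^ m * vars (γ.cube c t) j ∧
      vars (γ.cube c t) i ≠ P.q₂ ^ m * (P.q₁ * vars (γ.cube c t) j))

/-- The contour is one on which the block integrals, in all chambers, converge and are invariant
under the shifts `x_i → q₂⁻¹ x_i` of the variables. -/
def IsAdmissible (γ : Contour k) (A : Fin n → ℂ) : Prop :=
  ∀ (w : Equiv.Perm (Fin n)) (κ : Fin n → ℕ), ∑ α, κ α = k → ∀ σ : Equiv.Perm (Fin k),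
    γ.Converges (summand P A w κ σ) ∧
      ∀ S : Finset (Fin k),
        γ.integral (fun lam => summand P A w κ σ (shiftVars P S lam)) =
          γ.integral (summand P A w κ σ)

end Block

end TrigQKZ

end

/-!
The equation is assembled from two moves between chambers, and both are identities of integrands.

*Exchange of neighbours.* All stable envelopes are symmetrizations against the same weight
`W = ∏_{i<j} [t x_j/x_i]/[x_j/x_i]` (`hlWeight`, with `t = q₁`). Exchanging two adjacent variables
changes one factor of `W`, so that inside the symmetrization a factor `1/x_p` may be replaced by
`t/x_{p+1}`, as long as the rest is symmetric in these two variables (`hlSymm_exchange`). Hence the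
symmetrized products of `m` linear factors in a block of `m` variables all lie in the span of `m + 1`
functions, one for each degree, and the coordinates depend neither on the remaining variables nor on
the remaining factors (`exists_hlSymm_prod_br_eq`). The two-point stable envelopes of the two
chambers are therefore related by a constant matrix. Evaluating at the vacua identifies it with the
`R`-matrix, because there the stable envelope of the chamber `a_β ≻ a_α` is triangular with non-zero
diagonal (`isUnit_det_stabMatrix_swap`). Since the coordinates are insensitive to the surroundings,
the same relation holds for two neighbours in an `n`-point chamber (`stab_eq_sum_Rmat_mul_stab`), and
it integrates to a relation between blocks (`block_eq_R_block`).

*Going around the cycle.* Let `α` be the last operator of a chamber. When `a_α` and the variables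
attached to `α` are all multiplied by `q₂⁻¹`, the functional equation `(y)_∞ = (1 - y) (y/q₂)_∞`
produces exactly the factors that turn the corresponding summand of the stable envelope into the one
for the chamber in which `α` comes first (`screenFactor_div_left`, `matterFactor_shift`,
`summand_shift`). The powers of the shifted variables and the prefactor give `z ^ h_α`, and the shift
of the variables does not change the integral by the invariance of the contour (`block_shiftSpec`).

Starting from the chamber `1 ≻ ⋯ ≻ n`, the operator `α` is exchanged with its predecessors until it
is first, sent around the cycle, and exchanged with its successors until it is back in its place. The
intermediate chambers are `insertChamber α j`.
-/

noncomputable section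

namespace TrigQKZ

/-! ### Symmetrization with the Hall–Littlewood weight -/

/-- The weight `∏_{i<j} [t x_j/x_i]/[x_j/x_i]` that is common to all stable envelopes. -/
def hlWeight {k : ℕ} (t : ℂ) (x : Fin k → ℂ) : ℂ :=
  ∏ i, ∏ j ∈ Finset.Ioi i, br (t * (x j / x i)) / br (x j / x i)

/-- The symmetrization `∑_σ (W F)(x ∘ σ)` of `F` against the weight `W = hlWeight t`. -/
def hlSymm {k : ℕ} (t : ℂ) (F : (Fin k → ℂ) → ℂ) (x : Fin k → ℂ) : ℂ :=
  ∑ σ : Equiv.Perm (Fin k), hlWeight t (x ∘ σ) * F (x ∘ σ)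

lemma prod_Ioi_eq_prod_ite {k : ℕ} (f : Fin k → Fin k → ℂ) :
    ∏ i, ∏ j ∈ Finset.Ioi i, f i j = ∏ i, ∏ j, if i < j then f i j else 1 := by
  refine Finset.prod_congr rfl fun i _ => ?_
  rw [← Finset.prod_filter]
  refine Finset.prod_congr ?_ fun _ _ => rfl
  ext j
  simp

lemma swap_lt_swap_iff_of_adjacent {k : ℕ} {p q : Fin k} (hpq : (p : ℕ) + 1 = q) {i j : Fin k}
    (h₁ : ¬(i = p ∧ j = q)) (h₂ : ¬(i = q ∧ j = p)) :
    Equiv.swap p q i < Equiv.swap p q j ↔ i < j := by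
  simp only [Fin.ext_iff] at h₁ h₂
  simp only [Equiv.swap_apply_def, Fin.lt_def]
  split_ifs with h₃ h₄ h₅ h₆ h₇ <;> simp only [Fin.ext_iff] at * <;> omega

/-- Exchanging two adjacent variables changes only one factor of the weight. -/
lemma hlWeight_adjacent {k : ℕ} (t : ℂ) {p q : Fin k} (hpq : (p : ℕ) + 1 = q) (x : Fin k → ℂ) :
    ∃ c, hlWeight t x = c * (br (t * (x q / x p)) / br (x q / x p)) ∧
      hlWeight t (x ∘ Equiv.swap p q) = c * (br (t * (x p / x q)) / br (x p / x q)) := by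
  set g : Fin k → Fin k → ℂ := fun i j => br (t * (x j / x i)) / br (x j / x i) with hg
  set s := Equiv.swap p q with hs
  have hlt : p < q := by rw [Fin.lt_def]; omega
  have hne : p ≠ q := hlt.ne
  have e₁ : hlWeight t x = ∏ P : Fin k × Fin k, if P.1 < P.2 then g P.1 P.2 else 1 := by
    rw [hlWeight, prod_Ioi_eq_prod_ite, Fintype.prod_prod_type]
  have e₂ : hlWeight t (x ∘ s) =
      ∏ P : Fin k × Fin k, if s P.1 < s P.2 then g P.1 P.2 else 1 := by
    rw [hlWeight, prod_Ioi_eq_prod_ite, Fintype.prod_prod_type, ← Equiv.prod_comp s]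
    refine Finset.prod_congr rfl fun i _ => ?_
    rw [← Equiv.prod_comp s]
    refine Finset.prod_congr rfl fun j _ => ?_
    simp [hg, hs]
  have hmem : (q, p) ∈ Finset.univ.erase (p, q) := by simp [hne.symm]
  refine ⟨∏ P ∈ (Finset.univ.erase (p, q)).erase (q, p), if P.1 < P.2 then g P.1 P.2 else 1,
    ?_, ?_⟩
  · rw [e₁, ← Finset.mul_prod_erase _ _ (Finset.mem_univ (p, q)),
      ← Finset.mul_prod_erase _ _ hmem]
    simp only [hlt, hlt.not_gt, if_true, if_false, hg]
    ring
  · rw [e₂, ← Finset.mul_prod_erase _ _ (Finset.mem_univ (p, q)),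
      ← Finset.mul_prod_erase _ _ hmem]
    have : ∏ P ∈ (Finset.univ.erase (p, q)).erase (q, p), (if s P.1 < s P.2 then g P.1 P.2 else 1)
        = ∏ P ∈ (Finset.univ.erase (p, q)).erase (q, p), if P.1 < P.2 then g P.1 P.2 else 1 := by
      refine Finset.prod_congr rfl fun P hP => ?_
      simp only [Finset.mem_erase, Finset.mem_univ, and_true, ne_eq, Prod.ext_iff] at hP
      rw [hs, if_congr (swap_lt_swap_iff_of_adjacent hpq hP.2 hP.1) rfl rfl]
    rw [this]
    simp only [hs, Equiv.swap_apply_left, Equiv.swap_apply_right, hlt, hlt.not_gt, if_true,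
      if_false, hg]
    ring

lemma hlSymm_comp_perm {k : ℕ} (t : ℂ) (F : (Fin k → ℂ) → ℂ) (x : Fin k → ℂ)
    (s : Equiv.Perm (Fin k)) :
    hlSymm t F x = ∑ σ : Equiv.Perm (Fin k), hlWeight t (x ∘ σ ∘ s) * F (x ∘ σ ∘ s) := by
  rw [hlSymm, ← Equiv.sum_comp (Equiv.mulRight s)]
  rfl

lemma two_point_exchange {t a b : ℂ} (ha : a ≠ 0) (hb : b ≠ 0) (hab : a ≠ b) :
    br (t * (b / a)) / br (b / a) * a⁻¹ + br (t * (a / b)) / br (a / b) * b⁻¹ =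
      t * (br (t * (b / a)) / br (b / a) * b⁻¹ + br (t * (a / b)) / br (a / b) * a⁻¹) := by
  have h₁ : a - b ≠ 0 := sub_ne_zero.2 hab
  have e₁ : br (t * (b / a)) / br (b / a) = (a - t * b) / (a - b) := by
    rw [br, br, one_sub_div ha, ← mul_div_assoc, one_sub_div ha, div_div_div_cancel_right₀ ha]
  have e₂ : br (t * (a / b)) / br (a / b) = (t * a - b) / (a - b) := by
    rw [br, br, one_sub_div hb, ← mul_div_assoc, one_sub_div hb, div_div_div_cancel_right₀ hb,
      ← neg_sub, ← neg_sub a b, neg_div_neg_eq]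
  rw [e₁, e₂]
  field_simp
  ring

/-- The exchange relation of the symmetrization: moving a factor `1/x` to the next variable
costs a factor `t`. -/
lemma hlSymm_exchange {k : ℕ} (t : ℂ) {p q : Fin k} (hpq : (p : ℕ) + 1 = q)
    {F : (Fin k → ℂ) → ℂ} (hF : ∀ y, F (y ∘ Equiv.swap p q) = F y) {x : Fin k → ℂ}
    (hx : Function.Injective x) (hx0 : ∀ i, x i ≠ 0) :
    hlSymm t (fun y => F y * (y p)⁻¹) x = t * hlSymm t (fun y => F y * (y q)⁻¹) x := by
  have hne : p ≠ q := by rintro rfl; omega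
  -- Each permutation is paired with its composite with the transposition of `p` and `q`.
  have hdouble : ∀ G : (Fin k → ℂ) → ℂ, 2 * hlSymm t G x = ∑ σ : Equiv.Perm (Fin k),
      (hlWeight t (x ∘ σ) * G (x ∘ σ) +
        hlWeight t ((x ∘ σ) ∘ Equiv.swap p q) * G ((x ∘ σ) ∘ Equiv.swap p q)) := by
    intro G
    rw [Finset.sum_add_distrib, two_mul]
    congr 1
    exact hlSymm_comp_perm t G x (Equiv.swap p q)
  refine mul_left_cancel₀ (two_ne_zero (α := ℂ)) ?_
  rw [mul_left_comm, hdouble, hdouble, Finset.mul_sum]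
  refine Finset.sum_congr rfl fun σ _ => ?_
  obtain ⟨c, h₁, h₂⟩ := hlWeight_adjacent t hpq (x ∘ σ)
  rw [h₁, h₂, hF]
  simp only [Function.comp_apply, Equiv.swap_apply_left, Equiv.swap_apply_right]
  have := two_point_exchange (t := t) (hx0 (σ p)) (hx0 (σ q))
    (fun h => hne (σ.injective (hx h)))
  linear_combination c * F (x ∘ σ) * this

/-- `F` is symmetric in the variables of the block `e`. -/
def BlockSymmetric {k m : ℕ} (e : Fin m → Fin k) (F : (Fin k → ℂ) → ℂ) : Prop :=
  ∀ i j y, F (y ∘ Equiv.swap (e i) (e j)) = F y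

/-- `e` embeds `Fin m` as an interval of consecutive positions. -/
def IsInterval {k m : ℕ} (e : Fin m → Fin k) : Prop := ∃ b : ℕ, ∀ i, (e i : ℕ) = b + i

lemma IsInterval.injective {k m : ℕ} {e : Fin m → Fin k} (he : IsInterval e) :
    Function.Injective e := by
  obtain ⟨b, hb⟩ := he
  intro i j h
  have h₁ := hb i
  have h₂ := hb j
  rw [h] at h₁
  exact Fin.ext (by omega)

/-- The symmetrization of `F` times the monomial `∏_{i ∈ T} 1/x_i` in the variables of a block. -/
def monoSymm {k m : ℕ} (t : ℂ) (e : Fin m → Fin k) (F : (Fin k → ℂ) → ℂ) (T : Finset (Fin m))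
    (x : Fin k → ℂ) : ℂ :=
  hlSymm t (fun y => F y * ∏ i ∈ T, (y (e i))⁻¹) x

lemma monoSymm_exchange {k m : ℕ} (t : ℂ) {e : Fin m → Fin k} (he : IsInterval e)
    {F : (Fin k → ℂ) → ℂ} (hF : BlockSymmetric e F) {x : Fin k → ℂ}
    (hx : Function.Injective x) (hx0 : ∀ i, x i ≠ 0) {p q : Fin m} (hpq : (p : ℕ) + 1 = q)
    {U : Finset (Fin m)} (hp : p ∉ U) (hq : q ∉ U) :
    monoSymm t e F (insert p U) x = t * monoSymm t e F (insert q U) x := by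
  have hinj := he.injective
  obtain ⟨b, hb⟩ := he
  simp only [monoSymm, Finset.prod_insert hp, Finset.prod_insert hq]
  have := hlSymm_exchange t (p := e p) (q := e q) (by rw [hb, hb]; omega)
    (F := fun y => F y * ∏ i ∈ U, (y (e i))⁻¹) ?_ hx hx0
  · simpa only [mul_assoc, mul_comm (∏ i ∈ U, _)] using this
  · intro y
    simp only [hF p q y]
    congr 1
    refine Finset.prod_congr rfl fun i hi => ?_
    rw [Function.comp_apply, Equiv.swap_apply_of_ne_of_ne]
    · exact fun h => hp (hinj h ▸ hi)
    · exact fun h => hq (hinj h ▸ hi)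

lemma map_swap_insert {m : ℕ} {p q : Fin m} (hne : p ≠ q) {T : Finset (Fin m)} (hp : p ∈ T)
    (hq : q ∉ T) : T.map (Equiv.swap p q).toEmbedding = insert q (T.erase p) := by
  ext i
  rw [Finset.mem_map_equiv, Equiv.symm_swap, Finset.mem_insert, Finset.mem_erase]
  rcases eq_or_ne i p with rfl | hip
  · simp [hq, hne]
  rcases eq_or_ne i q with rfl | hiq
  · simp [hp]
  · simp [Equiv.swap_apply_of_ne_of_ne hip hiq, hip, hiq]

lemma map_swap_self {m : ℕ} {p q : Fin m} {T : Finset (Fin m)} (h : p ∈ T ↔ q ∈ T) :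
    T.map (Equiv.swap p q).toEmbedding = T := by
  ext i
  rw [Finset.mem_map_equiv, Equiv.symm_swap]
  rcases eq_or_ne i p with rfl | hip
  · simp [h]
  rcases eq_or_ne i q with rfl | hiq
  · simp [h]
  · simp [Equiv.swap_apply_of_ne_of_ne hip hiq]

/-- The factor depends neither on the surrounding variables nor on `F`: this is what lets
two-point identities be used inside an `n`-point function. -/
lemma exists_monoSymm_map_eq {m : ℕ} {t : ℂ} (ht : t ≠ 0) (τ : Equiv.Perm (Fin m)) :
    ∀ T : Finset (Fin m), ∃ c : ℂ, ∀ (k : ℕ) (e : Fin m → Fin k) (F : (Fin k → ℂ) → ℂ)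
      (x : Fin k → ℂ), IsInterval e → BlockSymmetric e F → Function.Injective x →
      (∀ i, x i ≠ 0) → monoSymm t e F (T.map τ.toEmbedding) x = c * monoSymm t e F T x := by
  rcases m with _ | m
  · intro T
    refine ⟨1, fun k e F x _ _ _ _ => ?_⟩
    rw [one_mul, Subsingleton.elim (T.map _) T]
  have hτ : τ ∈ Submonoid.closure (Set.range fun i : Fin m => Equiv.swap i.castSucc i.succ) := by
    rw [Equiv.Perm.mclosure_swap_castSucc_succ]; trivial
  induction hτ using Submonoid.closure_induction with
  | mem τ h =>
    obtain ⟨i, rfl⟩ := h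
    intro T
    have hne : i.castSucc ≠ i.succ := (Fin.castSucc_lt_succ).ne
    have hpq : ((i.castSucc : Fin (m + 1)) : ℕ) + 1 = (i.succ : Fin (m + 1)) := by simp
    by_cases hp : i.castSucc ∈ T <;> by_cases hq : i.succ ∈ T
    · exact ⟨1, fun k e F x _ _ _ _ => by rw [map_swap_self (by simp [hp, hq]), one_mul]⟩
    · refine ⟨t⁻¹, fun k e F x he hF hx hx0 => ?_⟩
      have := monoSymm_exchange t he hF hx hx0 hpq (U := T.erase i.castSucc) (by simp)
        (by simp [hq])
      rw [Finset.insert_erase hp] at this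
      rw [map_swap_insert hne hp hq, this, inv_mul_cancel_left₀ ht]
    · refine ⟨t, fun k e F x he hF hx hx0 => ?_⟩
      have := monoSymm_exchange t he hF hx hx0 hpq (U := T.erase i.succ) (by simp [hp]) (by simp)
      rw [Finset.insert_erase hq] at this
      change monoSymm t e F (T.map (Equiv.swap i.castSucc i.succ).toEmbedding) x = _
      rw [Equiv.swap_comm, map_swap_insert hne.symm hq hp, this]
    · exact ⟨1, fun k e F x _ _ _ _ => by rw [map_swap_self (by simp [hp, hq]), one_mul]⟩
  | one => exact fun T => ⟨1, fun k e F x _ _ _ _ => by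
      rw [one_mul]; exact congrArg (monoSymm t e F · x) T.map_refl⟩
  | mul τ₁ τ₂ _ _ h₁ h₂ =>
    intro T
    obtain ⟨c₂, hc₂⟩ := h₂ T
    obtain ⟨c₁, hc₁⟩ := h₁ (T.map τ₂.toEmbedding)
    refine ⟨c₁ * c₂, fun k e F x he hF hx hx0 => ?_⟩
    rw [mul_assoc, ← hc₂ k e F x he hF hx hx0, ← hc₁ k e F x he hF hx hx0, Finset.map_map]
    rfl

/-- The first `r` elements of `Fin m`. -/
def initialSet (m r : ℕ) : Finset (Fin m) := Finset.univ.filter fun i => (i : ℕ) < r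

lemma card_initialSet {m r : ℕ} (h : r ≤ m) : (initialSet m r).card = r := by
  rw [initialSet, Fin.card_filter_val_lt, min_eq_right h]

lemma exists_monoSymm_eq_initialSet {m : ℕ} {t : ℂ} (ht : t ≠ 0) (T : Finset (Fin m)) :
    ∃ c : ℂ, ∀ (k : ℕ) (e : Fin m → Fin k) (F : (Fin k → ℂ) → ℂ)
      (x : Fin k → ℂ), IsInterval e → BlockSymmetric e F → Function.Injective x →
      (∀ i, x i ≠ 0) → monoSymm t e F T x = c * monoSymm t e F (initialSet m T.card) x := by
  have hcard : (initialSet m T.card).card = T.card := card_initialSet (card_finset_fin_le T)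
  obtain ⟨τ, hτ⟩ : ∃ τ : Equiv.Perm (Fin m), (initialSet m T.card).map τ.toEmbedding = T := by
    classical
    let f : {i // i ∈ initialSet m T.card} ≃ {i // i ∈ T} := Finset.equivOfCardEq hcard
    refine ⟨f.extendSubtype, Finset.eq_of_subset_of_card_le (fun i hi => ?_) (by simp [hcard])⟩
    obtain ⟨j, hj, rfl⟩ := Finset.mem_map.1 hi
    exact f.extendSubtype_mem j hj
  obtain ⟨c, hc⟩ := exists_monoSymm_map_eq ht τ (initialSet m T.card)
  exact ⟨c, fun k e F x he hF hx hx0 => by rw [← hc k e F x he hF hx hx0, hτ]⟩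

/-- Symmetrized products of linear factors in the variables of a block lie in a space of dimension
`m + 1`, spanned by the symmetrizations of the monomials in `initialSet m r`, and their coordinates
do not depend on the other variables. -/
lemma exists_hlSymm_prod_br_eq {m : ℕ} {t : ℂ} (ht : t ≠ 0) (c : Fin m → ℂ) :
    ∃ Λ : Fin (m + 1) → ℂ, ∀ (k : ℕ) (e : Fin m → Fin k) (F : (Fin k → ℂ) → ℂ)
      (x : Fin k → ℂ), IsInterval e → BlockSymmetric e F → Function.Injective x →
      (∀ i, x i ≠ 0) → hlSymm t (fun y => F y * ∏ i, br (c i / y (e i))) x =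
        ∑ r : Fin (m + 1), Λ r * monoSymm t e F (initialSet m r) x := by
  choose d hd using fun T : Finset (Fin m) => exists_monoSymm_eq_initialSet ht T
  refine ⟨fun r => ∑ T ∈ (Finset.univ : Finset (Finset (Fin m))).filter (fun T => T.card = (r : ℕ)),
    (∏ i ∈ T, -c i) * d T, fun k e F x he hF hx hx0 => ?_⟩
  have hexp : ∀ y : Fin k → ℂ, ∏ i, br (c i / y (e i)) =
      ∑ T : Finset (Fin m), (∏ i ∈ T, -c i) * ∏ i ∈ T, (y (e i))⁻¹ := by
    intro y
    have : ∀ i, br (c i / y (e i)) = -c i * (y (e i))⁻¹ + 1 := fun i => by rw [br]; ring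
    simp only [this, Finset.prod_add, Finset.prod_const_one, mul_one, Finset.powerset_univ,
      Finset.prod_mul_distrib]
  -- Expand the product, replace each monomial by the one of its degree, and collect the degrees.
  calc hlSymm t (fun y => F y * ∏ i, br (c i / y (e i))) x
      = ∑ T : Finset (Fin m), (∏ i ∈ T, -c i) * monoSymm t e F T x := by
        simp only [hlSymm, monoSymm, hexp, Finset.mul_sum]
        rw [Finset.sum_comm]
        exact Finset.sum_congr rfl fun T _ => Finset.sum_congr rfl fun σ _ => by ring
    _ = ∑ T : Finset (Fin m),
          (∏ i ∈ T, -c i) * d T * monoSymm t e F (initialSet m T.card) x :=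
        Finset.sum_congr rfl fun T _ => by rw [hd T k e F x he hF hx hx0, mul_assoc]
    _ = _ := by
        simp only [Finset.sum_mul, Finset.sum_filter]
        rw [Finset.sum_comm]
        refine Finset.sum_congr rfl fun T _ => ?_
        have hT : T.card < m + 1 := Nat.lt_succ_of_le (card_finset_fin_le T)
        rw [Finset.sum_eq_single ⟨T.card, hT⟩]
        · simp
        · intro r _ hr
          rw [if_neg (fun h : T.card = (r : ℕ) => hr (Fin.ext h.symm)), zero_mul]
        · simp

/-! ### The two-point functions and the `R`-matrix -/

/-- The coefficients of `r` linear factors `[u/x]` followed by factors `[v/x]`. -/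
def pairCoeff {m : ℕ} (r : ℕ) (u v : ℂ) (i : Fin m) : ℂ := if (i : ℕ) < r then u else v

/-- For two operators the stable envelope is the symmetrization of a product of linear factors, one
for each variable. -/
lemma stabTerm_two {m : ℕ} (t : ℂ) (K a : Fin 2 → ℂ) (w : Equiv.Perm (Fin 2)) (κ : Fin 2 → ℕ)
    (hκ : κ (w 0) + κ (w 1) = m) (x : Fin m → ℂ) :
    stabTerm t K a w κ x = hlWeight t x *
      ∏ i, br (pairCoeff (κ (w 1)) (a (w 0)) (K (w 1) * a (w 1)) i / x i) := by
  have h₀ : Finset.Ioi (0 : Fin 2) = {1} := by decide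
  have h₁ : Finset.Ioi (1 : Fin 2) = ∅ := by decide
  have h₂ : Finset.Iio (0 : Fin 2) = ∅ := by decide
  have h₃ : Finset.Iio (1 : Fin 2) = {0} := by decide
  rw [stabTerm, hlWeight]
  congr 1
  refine Finset.prod_congr rfl fun i _ => ?_
  rw [Fin.prod_univ_two]
  simp only [HasColor, blockStart, h₀, h₁, h₂, h₃, Finset.sum_singleton, Finset.sum_empty,
    Finset.prod_singleton, Finset.prod_empty, one_mul, mul_one, zero_add, pairCoeff]
  have hi := i.2
  by_cases h : (i : ℕ) < κ (w 1)
  · rw [if_neg (by omega), if_pos ⟨by omega, h⟩, if_pos h, one_mul]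
  · rw [if_pos ⟨by omega, by omega⟩, if_neg (by omega), if_neg h, mul_one]

lemma zpow_injective_of_one_lt_norm {t : ℂ} (ht : 1 < ‖t‖) :
    Function.Injective fun n : ℤ => t ^ n := by
  intro i j h
  have h' := congrArg norm h
  simp only [norm_zpow] at h'
  exact zpow_right_injective₀ (by linarith) ht.ne' h'

lemma hlWeight_eq_zero {k : ℕ} {t : ℂ} {x : Fin k → ℂ} {i j : Fin k} (hij : i < j)
    (h0 : x i ≠ 0) (h : x i = t * x j) : hlWeight t x = 0 := by
  refine Finset.prod_eq_zero (Finset.mem_univ i)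
    (Finset.prod_eq_zero (Finset.mem_Ioi.2 hij) ?_)
  rw [← mul_div_assoc, ← h, div_self h0, br, sub_self, zero_div]

section Vacuum

variable {t u : ℂ} {m : ℕ}

lemma vacuum_of_lt {l : ℕ} {i : Fin m} (h : (i : ℕ) < l) :
    vacuum t ![1, u] m l i = t ^ (i : ℕ) := by
  simp [vacuum, h]

lemma vacuum_of_le {l : ℕ} {i : Fin m} (h : l ≤ (i : ℕ)) :
    vacuum t ![1, u] m l i = u * t ^ ((i : ℕ) - l) := by
  simp [vacuum, h.not_gt]

lemma vacuum_ne_zero (ht : 1 < ‖t‖) (hu0 : u ≠ 0) (l : ℕ) (i : Fin m) :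
    vacuum t ![1, u] m l i ≠ 0 := by
  have ht0 : t ≠ 0 := by rintro rfl; simp at ht; linarith
  rcases lt_or_ge (i : ℕ) l with h | h
  · rw [vacuum_of_lt h]; exact pow_ne_zero _ ht0
  · rw [vacuum_of_le h]; exact mul_ne_zero hu0 (pow_ne_zero _ ht0)

lemma mul_pow_ne_pow (ht : 1 < ‖t‖) (hu : ∀ n : ℤ, u ≠ t ^ n) (a b : ℕ) :
    u * t ^ a ≠ t ^ b := by
  have ht0 : t ≠ 0 := by rintro rfl; simp at ht; linarith
  intro h
  refine hu (b - a) ?_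
  rw [zpow_sub₀ ht0, zpow_natCast, zpow_natCast, ← h, mul_div_cancel_right₀ _ (pow_ne_zero _ ht0)]

lemma vacuum_injective (ht : 1 < ‖t‖) (hu0 : u ≠ 0) (hu : ∀ n : ℤ, u ≠ t ^ n) (l : ℕ) :
    Function.Injective (vacuum t ![1, u] m l) := by
  have hpow : ∀ a b : ℕ, t ^ a = t ^ b → a = b := fun a b h => by
    have := zpow_injective_of_one_lt_norm ht (a₁ := a) (a₂ := b) (by simpa using h)
    exact_mod_cast this
  intro i j h
  rcases lt_or_ge (i : ℕ) l with hi | hi <;> rcases lt_or_ge (j : ℕ) l with hj | hj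
  · rw [vacuum_of_lt hi, vacuum_of_lt hj] at h
    exact Fin.ext (hpow _ _ h)
  · rw [vacuum_of_lt hi, vacuum_of_le hj] at h
    exact absurd h.symm (mul_pow_ne_pow ht hu _ _)
  · rw [vacuum_of_le hi, vacuum_of_lt hj] at h
    exact absurd h (mul_pow_ne_pow ht hu _ _)
  · rw [vacuum_of_le hi, vacuum_of_le hj] at h
    have := hpow _ _ (mul_left_cancel₀ hu0 h)
    exact Fin.ext (by omega)

/-- If the weight does not vanish at a permuted vacuum, the permutation keeps the order inside each
of the two strings of the vacuum. -/
lemma symm_lt_symm_of_hlWeight_ne_zero (ht : 1 < ‖t‖) (hu0 : u ≠ 0) {l : ℕ}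
    {σ : Equiv.Perm (Fin m)} (hσ : hlWeight t (vacuum t ![1, u] m l ∘ σ) ≠ 0) {a b : Fin m}
    (hab : (a : ℕ) + 1 = b) (h : (b : ℕ) < l ∨ l ≤ (a : ℕ)) : σ.symm a < σ.symm b := by
  by_contra hlt
  have hne : σ.symm b ≠ σ.symm a := fun h => by
    have := σ.symm.injective h
    rw [this] at hab
    omega
  refine hσ (hlWeight_eq_zero (lt_of_le_of_ne (not_lt.1 hlt) hne) (vacuum_ne_zero ht hu0 _ _) ?_)
  simp only [Function.comp_apply, Equiv.apply_symm_apply]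
  rcases h with h | h
  · rw [vacuum_of_lt h, vacuum_of_lt (by omega), ← hab, pow_succ']
  · rw [vacuum_of_le h, vacuum_of_le (by omega), ← hab, Nat.sub_add_comm h, pow_succ']
    ring

/-- If moreover the factors `[u/x]` at the first `j` positions do not vanish, the string that starts
at `u` occupies only later positions. -/
lemma le_symm_of_ne_zero (ht : 1 < ‖t‖) (hu0 : u ≠ 0) {l j : ℕ}
    {σ : Equiv.Perm (Fin m)} (hσ : hlWeight t (vacuum t ![1, u] m l ∘ σ) ≠ 0)
    (hbr : ∀ i : Fin m, (i : ℕ) < j → br (u / vacuum t ![1, u] m l (σ i)) ≠ 0) (b : Fin m)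
    (hb : l ≤ (b : ℕ)) : j ≤ (σ.symm b : ℕ) := by
  obtain ⟨b, hbm⟩ := b
  simp only at hb
  induction b, hb using Nat.le_induction with
  | base =>
    by_contra hlt
    refine hbr _ (not_le.1 hlt) ?_
    rw [Equiv.apply_symm_apply, vacuum_of_le (i := ⟨l, hbm⟩) le_rfl]
    simp [br, hu0]
  | succ b hb ih =>
    have h₁ := ih (by omega)
    have h₂ := symm_lt_symm_of_hlWeight_ne_zero ht hu0 hσ (a := ⟨b, by omega⟩)
      (b := ⟨b + 1, hbm⟩) rfl (Or.inr hb)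
    rw [Fin.lt_def] at h₂
    omega

lemma card_filter_le (m l : ℕ) :
    ((Finset.univ : Finset (Fin m)).filter fun b : Fin m => l ≤ (b : ℕ)).card = m - l := by
  have h := Finset.card_filter_add_card_filter_not (s := (Finset.univ : Finset (Fin m)))
    (fun b : Fin m => (b : ℕ) < l)
  simp only [not_lt] at h
  rw [Fin.card_filter_val_lt, Finset.card_univ, Fintype.card_fin] at h
  omega

/-- The triangularity of the stable envelope at the vacua. -/
lemma le_of_ne_zero (ht : 1 < ‖t‖) (hu0 : u ≠ 0) {l j : ℕ} (hj : j ≤ m)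
    {σ : Equiv.Perm (Fin m)} (hσ : hlWeight t (vacuum t ![1, u] m l ∘ σ) ≠ 0)
    (hbr : ∀ i : Fin m, (i : ℕ) < j → br (u / vacuum t ![1, u] m l (σ i)) ≠ 0) : j ≤ l := by
  have h := Finset.card_le_card_of_injOn σ.symm
    (s := Finset.univ.filter fun b : Fin m => l ≤ (b : ℕ))
    (t := Finset.univ.filter fun b : Fin m => j ≤ (b : ℕ))
    (fun b hb => by
      simp only [Finset.coe_filter, Finset.mem_univ, true_and, Set.mem_ofPred_eq] at hb ⊢
      exact le_symm_of_ne_zero ht hu0 hσ hbr b hb) σ.symm.injective.injOn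
  rw [card_filter_le, card_filter_le] at h
  omega

/-- On the diagonal only the identity permutation contributes. -/
lemma eq_one_of_ne_zero (ht : 1 < ‖t‖) (hu0 : u ≠ 0) {l : ℕ}
    {σ : Equiv.Perm (Fin m)} (hσ : hlWeight t (vacuum t ![1, u] m l ∘ σ) ≠ 0)
    (hbr : ∀ i : Fin m, (i : ℕ) < l → br (u / vacuum t ![1, u] m l (σ i)) ≠ 0) : σ = 1 := by
  have hle := le_symm_of_ne_zero ht hu0 hσ hbr
  -- `σ⁻¹` maps the positions `≥ l` injectively to themselves, hence also those `< l`.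
  have hlt : ∀ a : Fin m, (a : ℕ) < l → (σ.symm a : ℕ) < l := by
    intro a ha
    by_contra h
    set s := Finset.univ.filter fun b : Fin m => l ≤ (b : ℕ) with hs
    have himg : s.map σ.symm.toEmbedding = s := by
      refine Finset.eq_of_subset_of_card_le (fun b hb => ?_) (by simp)
      obtain ⟨c, hc, rfl⟩ := Finset.mem_map.1 hb
      exact Finset.mem_filter.2 ⟨Finset.mem_univ _, hle c (Finset.mem_filter.1 hc).2⟩
    have hmem : σ.symm a ∈ s := Finset.mem_filter.2 ⟨Finset.mem_univ _, not_lt.1 h⟩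
    rw [← himg] at hmem
    obtain ⟨c, hc, hca⟩ := Finset.mem_map.1 hmem
    have := σ.symm.injective hca
    subst this
    exact absurd (Finset.mem_filter.1 hc).2 (not_le.2 ha)
  have hmono : StrictMono σ.symm := by
    rcases m with _ | m
    · exact fun i => i.elim0
    refine Fin.strictMono_iff_lt_succ.2 fun i => ?_
    by_cases hi : (i : ℕ) + 1 = l
    · have h₁ := hlt i.castSucc (by simp; omega)
      have h₂ := hle i.succ (by simp; omega)
      rw [Fin.lt_def]
      omega
    · exact symm_lt_symm_of_hlWeight_ne_zero ht hu0 hσ (by simp) (by simp; omega)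
  have : (σ.symm : Fin m → Fin m) = id :=
    StrictMono.range_inj hmono strictMono_id |>.1 (by simp [σ.symm.surjective.range_eq])
  ext i
  have := congrFun this (σ i)
  simp only [Equiv.symm_apply_apply, id] at this
  simp [← this]

end Vacuum

lemma stab_two_eq_hlSymm {m : ℕ} (t : ℂ) (K a : Fin 2 → ℂ) (w : Equiv.Perm (Fin 2))
    (κ : Fin 2 → ℕ) (hκ : κ (w 0) + κ (w 1) = m) (x : Fin m → ℂ) :
    stab t K a w κ x = hlSymm t (fun y => 1 *
      ∏ i, br (pairCoeff (κ (w 1)) (a (w 0)) (K (w 1) * a (w 1)) i / y i)) x := by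
  simp only [stab, hlSymm, one_mul, stabTerm_two t K a w κ hκ]

section RMatrix

variable {t Kα Kβ u : ℂ} {m : ℕ}

lemma stabMatrix_one_apply (j l : Fin (m + 1)) :
    stabMatrix t ![Kα, Kβ] ![1, u] 1 m j l = hlSymm t (fun y => 1 *
      ∏ i, br (pairCoeff (m - j) 1 (Kβ * u) i / y i)) (vacuum t ![1, u] m l) := by
  rw [stabMatrix, Matrix.of_apply, stab_two_eq_hlSymm]
  · simp
  · simp; omega

lemma stabMatrix_swap_apply (j l : Fin (m + 1)) :
    stabMatrix t ![Kα, Kβ] ![1, u] (Equiv.swap 0 1) m j l = hlSymm t (fun y => 1 *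
      ∏ i, br (pairCoeff j u Kα i / y i)) (vacuum t ![1, u] m l) := by
  rw [stabMatrix, Matrix.of_apply, stab_two_eq_hlSymm]
  · simp
  · simp; omega

/-- Off the resonances the stable envelope of the chamber `a_β ≻ a_α` is triangular with non-zero
diagonal at the vacua, as only the identity permutation contributes there. -/
lemma isUnit_det_stabMatrix_swap (ht : 1 < ‖t‖) (hu0 : u ≠ 0)
    (hu : ∀ n : ℤ, u ≠ t ^ n ∧ u ≠ Kα * t ^ n) :
    IsUnit (stabMatrix t ![Kα, Kβ] ![1, u] (Equiv.swap 0 1) m).det := by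
  have ht0 : t ≠ 0 := by rintro rfl; simp at ht; linarith
  have hbr : ∀ {j l : ℕ} {σ : Equiv.Perm (Fin m)},
      (∏ i, br (pairCoeff j u Kα i / (vacuum t ![1, u] m l ∘ σ) i)) ≠ 0 →
      ∀ i : Fin m, (i : ℕ) < j → br (u / vacuum t ![1, u] m l (σ i)) ≠ 0 := by
    intro j l σ h i hi
    have := Finset.prod_ne_zero_iff.1 h i (Finset.mem_univ i)
    rwa [pairCoeff, if_pos hi] at this
  have htri : (stabMatrix t ![Kα, Kβ] ![1, u] (Equiv.swap 0 1) m).BlockTriangular id := by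
    intro j l hlj
    rw [stabMatrix_swap_apply]
    refine Finset.sum_eq_zero fun σ _ => ?_
    by_contra h
    simp only [one_mul] at h
    have := le_of_ne_zero ht hu0 (Nat.lt_succ_iff.1 j.2) (left_ne_zero_of_mul h)
      (hbr (right_ne_zero_of_mul h))
    exact absurd hlj (not_lt.2 this)
  rw [Matrix.det_of_isUpperTriangular htri, isUnit_iff_ne_zero, Finset.prod_ne_zero_iff]
  intro l _
  rw [stabMatrix_swap_apply, hlSymm, Finset.sum_eq_single 1]
  · simp only [one_mul, Equiv.Perm.coe_one, Function.comp_id]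
    have hpow : ∀ d : ℕ, d ≠ 0 → t ^ d ≠ 1 := fun d hd h => by
      have := zpow_injective_of_one_lt_norm ht (a₁ := d) (a₂ := 0) (by simpa using h)
      exact hd (by exact_mod_cast this)
    refine mul_ne_zero (Finset.prod_ne_zero_iff.2 fun i _ => Finset.prod_ne_zero_iff.2
      fun j hj => ?_) (Finset.prod_ne_zero_iff.2 fun i _ => ?_)
    · have hij : i < j := Finset.mem_Ioi.1 hj
      have hi0 := vacuum_ne_zero ht hu0 (l : ℕ) i
      refine div_ne_zero (sub_ne_zero.2 fun h => ?_) (sub_ne_zero.2 fun h => ?_)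
      · rw [← mul_div_assoc, eq_comm, div_eq_one_iff_eq hi0] at h
        rw [Fin.lt_def] at hij
        rcases lt_or_ge (i : ℕ) l with hi | hi <;> rcases lt_or_ge (j : ℕ) l with hj | hj
        · rw [vacuum_of_lt hi, vacuum_of_lt hj, ← pow_succ',
            ← Nat.sub_add_cancel (by omega : (i : ℕ) ≤ j + 1), pow_add] at h
          exact hpow (j + 1 - i) (by omega)
            (mul_right_cancel₀ (pow_ne_zero _ ht0) (h.trans (one_mul _).symm))
        · rw [vacuum_of_lt hi, vacuum_of_le hj, mul_left_comm, ← pow_succ'] at h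
          exact mul_pow_ne_pow ht (fun n => (hu n).1) _ _ h
        · omega
        · rw [vacuum_of_le hi, vacuum_of_le hj, mul_left_comm, ← pow_succ'] at h
          have h := mul_left_cancel₀ hu0 h
          rw [← Nat.sub_add_cancel (by omega : (i : ℕ) - l ≤ j - l + 1), pow_add] at h
          exact hpow (j - l + 1 - (i - l)) (by omega)
            (mul_right_cancel₀ (pow_ne_zero _ ht0) (h.trans (one_mul _).symm))
      · rw [eq_comm, div_eq_one_iff_eq hi0] at h
        exact hij.ne' (vacuum_injective ht hu0 (fun n => (hu n).1) _ h)
    · have hi0 := vacuum_ne_zero ht hu0 (l : ℕ) i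
      refine sub_ne_zero.2 fun h => ?_
      rw [eq_comm, div_eq_one_iff_eq hi0, pairCoeff] at h
      rcases lt_or_ge (i : ℕ) l with hi | hi
      · rw [if_pos hi, vacuum_of_lt hi] at h
        exact (hu i).1 (by rw [h, zpow_natCast])
      · rw [if_neg (not_lt.2 hi), vacuum_of_le hi] at h
        refine (hu (-((i : ℕ) - (l : ℕ) : ℕ))).2 ?_
        rw [h, zpow_neg, zpow_natCast, mul_inv_cancel_right₀ (pow_ne_zero _ ht0)]
  · intro σ _ hσ
    by_contra h
    simp only [one_mul] at h
    exact hσ (eq_one_of_ne_zero ht hu0 (left_ne_zero_of_mul h) (hbr (right_ne_zero_of_mul h)))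
  · simp

/-- The `R`-matrix relates the stable envelopes of the two chambers off-shell, and also when the
two operators are part of a larger configuration: `F` collects the remaining factors. -/
lemma hlSymm_eq_sum_Rmat (ht : 1 < ‖t‖) (hu0 : u ≠ 0)
    (hu : ∀ n : ℤ, u ≠ t ^ n ∧ u ≠ Kα * t ^ n) (j : Fin (m + 1)) {k : ℕ} {e : Fin m → Fin k}
    {F : (Fin k → ℂ) → ℂ} {x : Fin k → ℂ} (he : IsInterval e) (hF : BlockSymmetric e F)
    (hx : Function.Injective x) (hx0 : ∀ i, x i ≠ 0) :
    hlSymm t (fun y => F y * ∏ i, br (pairCoeff (m - j) 1 (Kβ * u) i / y (e i))) x =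
      ∑ l : Fin (m + 1), Rmat t Kα Kβ u m j l *
        hlSymm t (fun y => F y * ∏ i, br (pairCoeff l u Kα i / y (e i))) x := by
  have ht0 : t ≠ 0 := by rintro rfl; simp at ht; linarith
  choose Λ₁ h₁ using fun j : Fin (m + 1) =>
    exists_hlSymm_prod_br_eq ht0 (pairCoeff (m := m) (m - j) 1 (Kβ * u))
  choose Λ₂ h₂ using fun j : Fin (m + 1) =>
    exists_hlSymm_prod_br_eq ht0 (pairCoeff (m := m) j u Kα)
  -- Both stable envelope matrices factor through the matrix `G` of the values of the spanning
  -- functions at the vacua, which is invertible since the second of them is.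
  let G : Matrix (Fin (m + 1)) (Fin (m + 1)) ℂ := Matrix.of fun r l =>
    monoSymm t id (fun _ => 1) (initialSet m r) (vacuum t ![1, u] m l)
  have hid : IsInterval (id : Fin m → Fin m) := ⟨0, by simp⟩
  have hone : BlockSymmetric (id : Fin m → Fin m) fun _ => 1 := fun _ _ _ => rfl
  have hS₁ : stabMatrix t ![Kα, Kβ] ![1, u] 1 m = Matrix.of Λ₁ * G := by
    ext j l
    rw [stabMatrix_one_apply, Matrix.mul_apply]
    exact h₁ j m id (fun _ => 1) _ hid hone (vacuum_injective ht hu0 (fun n => (hu n).1) _)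
      (vacuum_ne_zero ht hu0 _)
  have hS₂ : stabMatrix t ![Kα, Kβ] ![1, u] (Equiv.swap 0 1) m = Matrix.of Λ₂ * G := by
    ext j l
    rw [stabMatrix_swap_apply, Matrix.mul_apply]
    exact h₂ j m id (fun _ => 1) _ hid hone (vacuum_injective ht hu0 (fun n => (hu n).1) _)
      (vacuum_ne_zero ht hu0 _)
  have hunit := isUnit_det_stabMatrix_swap (Kβ := Kβ) (m := m) ht hu0 hu
  have hR : Rmat t Kα Kβ u m * Matrix.of Λ₂ = Matrix.of Λ₁ := by
    have hG : IsUnit G.det := by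
      rw [hS₂, Matrix.det_mul] at hunit
      exact isUnit_of_mul_isUnit_right hunit
    have : Rmat t Kα Kβ u m * Matrix.of Λ₂ * G = Matrix.of Λ₁ * G := by
      rw [Matrix.mul_assoc, ← hS₂, ← hS₁, Rmat, Matrix.mul_assoc, Matrix.nonsing_inv_mul _ hunit,
        Matrix.mul_one]
    calc Rmat t Kα Kβ u m * Matrix.of Λ₂
        = Rmat t Kα Kβ u m * Matrix.of Λ₂ * G * G⁻¹ :=
          (Matrix.mul_nonsing_inv_cancel_right _ _ hG).symm
      _ = Matrix.of Λ₁ := by rw [this, Matrix.mul_nonsing_inv_cancel_right _ _ hG]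
  rw [h₁ j k e F x he hF hx hx0]
  simp only [fun l => h₂ l k e F x he hF hx hx0, Finset.mul_sum]
  rw [Finset.sum_comm]
  refine Finset.sum_congr rfl fun r _ => ?_
  have := congrFun (congrFun hR j) r
  rw [Matrix.mul_apply, Matrix.of_apply] at this
  rw [← this, Finset.sum_mul]
  exact Finset.sum_congr rfl fun l _ => by rw [Matrix.of_apply, mul_assoc]

end RMatrix

/-! ### Adjacent chambers -/

section Adjacent

variable {n k : ℕ}

lemma blockStart_add_le_of_lt (w : Equiv.Perm (Fin n)) (κ : Fin n → ℕ) {r s : Fin n} (h : r < s) :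
    blockStart w κ s + κ (w s) ≤ blockStart w κ r := by
  rw [blockStart, blockStart, add_comm, ← Finset.sum_insert (f := fun r => κ (w r)) (by simp)]
  refine Finset.sum_le_sum_of_subset fun i hi => ?_
  rcases Finset.mem_insert.1 hi with rfl | hi
  · exact Finset.mem_Ioi.2 h
  · exact Finset.mem_Ioi.2 (h.trans (Finset.mem_Ioi.1 hi))

lemma blockStart_add_le_sum (w : Equiv.Perm (Fin n)) (κ : Fin n → ℕ) (r : Fin n) :
    blockStart w κ r + κ (w r) ≤ ∑ α, κ α := by
  rw [blockStart, add_comm, ← Finset.sum_insert (f := fun r => κ (w r)) (by simp),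
    ← Equiv.sum_comp w]
  exact Finset.sum_le_sum_of_subset (Finset.subset_univ _)

/-- The factor of the stable envelope of a variable `z` attached to the operator in position `r`. -/
def colorFactor (K a : Fin n → ℂ) (w : Equiv.Perm (Fin n)) (r : Fin n) (z : ℂ) : ℂ :=
  (∏ s ∈ Finset.Iio r, br (a (w s) / z)) * ∏ s ∈ Finset.Ioi r, br (K (w s) * a (w s) / z)

open scoped Classical in
lemma stabTerm_eq (t : ℂ) (K a : Fin n → ℂ) (w : Equiv.Perm (Fin n)) (κ : Fin n → ℕ)
    (x : Fin k → ℂ) : stabTerm t K a w κ x =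
      hlWeight t x * ∏ i, ∏ r, if HasColor w κ i r then colorFactor K a w r (x i) else 1 :=
  rfl

open scoped Classical in
/-- The part of the stable envelope, without its weight, that does not distinguish the two operators
in the adjacent positions `p` and `q`, whose variables form the block `e`. -/
def pairOuter {m : ℕ} (K a : Fin n → ℂ) (w : Equiv.Perm (Fin n)) (κ : Fin n → ℕ) (p q : Fin n)
    (e : Fin m → Fin k) (y : Fin k → ℂ) : ℂ :=
  (∏ i, ∏ r ∈ (Finset.univ.erase p).erase q,
    if HasColor w κ i r then colorFactor K a w r (y i) else 1) *
  ∏ i, ((∏ s ∈ Finset.Iio p, br (a (w s) / y (e i))) *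
    ∏ s ∈ Finset.Ioi q, br (K (w s) * a (w s) / y (e i)))

lemma hlSymm_scale (t : ℂ) (F : (Fin k → ℂ) → ℂ) (x : Fin k → ℂ) {c : ℂ} (hc : c ≠ 0) :
    hlSymm t F x = hlSymm t (fun y => F fun i => c * y i) (fun i => c⁻¹ * x i) := by
  refine Finset.sum_congr rfl fun σ _ => ?_
  have h₁ : hlWeight t ((fun i => c⁻¹ * x i) ∘ σ) = hlWeight t (x ∘ σ) := by
    refine Finset.prod_congr rfl fun i _ => Finset.prod_congr rfl fun j _ => ?_
    simp only [Function.comp_apply, mul_div_mul_left _ _ (inv_ne_zero hc)]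
  have h₂ : (fun i => c * ((fun i => c⁻¹ * x i) ∘ σ) i) = x ∘ σ := by
    funext i
    simp [mul_inv_cancel_left₀ hc]
  rw [h₁]
  exact congrArg (fun y => hlWeight t (x ∘ σ) * F y) h₂.symm

lemma pairCoeff_div_mul {m : ℕ} (r : ℕ) (u v c z : ℂ) (i : Fin m) :
    pairCoeff r u v i / (c * z) = pairCoeff r (u / c) (v / c) i / z := by
  rw [pairCoeff, pairCoeff]
  split_ifs <;> rw [div_div]

variable {p q : Fin n} (hpq : (p : ℕ) + 1 = q) {w : Equiv.Perm (Fin n)} {κ : Fin n → ℕ}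

include hpq

lemma Ioi_eq_insert_of_adjacent : Finset.Ioi p = insert q (Finset.Ioi q) := by
  ext i
  simp only [Finset.mem_Ioi, Finset.mem_insert, Fin.lt_def, Fin.ext_iff]
  omega

lemma Iio_eq_insert_of_adjacent : Finset.Iio q = insert p (Finset.Iio p) := by
  ext i
  simp only [Finset.mem_Iio, Finset.mem_insert, Fin.lt_def, Fin.ext_iff]
  omega

lemma blockStart_adjacent : blockStart w κ p = blockStart w κ q + κ (w q) := by
  rw [blockStart, Ioi_eq_insert_of_adjacent hpq, Finset.sum_insert (by simp), add_comm]
  rfl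

section Pair

variable {m : ℕ} (hm : κ (w p) + κ (w q) = m) {e : Fin m → Fin k}
  (he : ∀ i, (e i : ℕ) = blockStart w κ q + i)

include hm he

lemma not_hasColor_block {r : Fin n} (hp : r ≠ p) (hq : r ≠ q) (i : Fin m) :
    ¬HasColor w κ (e i) r := by
  have hi := i.2
  have h₁ := blockStart_adjacent (w := w) (κ := κ) hpq
  rintro ⟨h₂, h₃⟩
  rw [he] at h₂ h₃
  rcases lt_or_ge r p with h | h
  · have := blockStart_add_le_of_lt w κ h
    omega
  · have h' : q < r := by
      rw [Fin.lt_def]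
      have h₄ : (r : ℕ) ≠ p := fun h => hp (Fin.ext h)
      have h₅ : (r : ℕ) ≠ q := fun h => hq (Fin.ext h)
      rw [Fin.le_def] at h
      omega
    have := blockStart_add_le_of_lt w κ h'
    omega

/-- The stable envelope splits into the weight, a factor that is common to both orders of the pair,
and a two-point stable envelope in the block of the pair. -/
lemma stabTerm_eq_pairOuter_mul (t : ℂ) (K a : Fin n → ℂ) (x : Fin k → ℂ) :
    stabTerm t K a w κ x = hlWeight t x * (pairOuter K a w κ p q e x *
      ∏ i, br (pairCoeff (κ (w q)) (a (w p)) (K (w q) * a (w q)) i / x (e i))) := by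
  classical
  have hne : q ≠ p := by rintro rfl; omega
  have hinj : Function.Injective e := IsInterval.injective ⟨_, he⟩
  have h₁ := blockStart_adjacent (w := w) (κ := κ) hpq
  rw [stabTerm_eq, pairOuter]
  congr 1
  rw [mul_assoc, ← Finset.prod_mul_distrib]
  have hsplit : ∀ i : Fin k,
      (∏ r, if HasColor w κ i r then colorFactor K a w r (x i) else 1) =
      (∏ r ∈ (Finset.univ.erase p).erase q,
        if HasColor w κ i r then colorFactor K a w r (x i) else 1) *
      ((if HasColor w κ i p then colorFactor K a w p (x i) else 1) *
        if HasColor w κ i q then colorFactor K a w q (x i) else 1) := by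
    intro i
    rw [← Finset.mul_prod_erase _ _ (Finset.mem_univ p),
      ← Finset.mul_prod_erase _ _ (Finset.mem_erase.2 ⟨hne, Finset.mem_univ q⟩)]
    ring
  rw [Finset.prod_congr rfl fun i _ => hsplit i, Finset.prod_mul_distrib]
  congr 1
  symm
  refine Fintype.prod_of_injective e hinj _ _ (fun i hi => ?_) fun i => ?_
  · have hout : ¬(blockStart w κ q ≤ (i : ℕ) ∧ (i : ℕ) < blockStart w κ q + m) := by
      rintro ⟨h₂, h₃⟩
      exact hi ⟨⟨i - blockStart w κ q, by omega⟩, Fin.ext (by rw [he]; simp; omega)⟩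
    rw [if_neg, if_neg, mul_one]
    · rintro ⟨h₂, h₃⟩; omega
    · rintro ⟨h₂, h₃⟩; omega
  · have hi := i.2
    simp only [HasColor, he, colorFactor, Ioi_eq_insert_of_adjacent hpq,
      Iio_eq_insert_of_adjacent hpq]
    rw [Finset.prod_insert (by simp), Finset.prod_insert (by simp), pairCoeff]
    by_cases h : (i : ℕ) < κ (w q)
    · rw [if_pos h, if_neg (by omega), if_pos (by omega)]
      ring
    · rw [if_neg h, if_pos (by omega), if_neg (by omega)]
      ring

lemma blockSymmetric_pairOuter (K a : Fin n → ℂ) :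
    BlockSymmetric e (pairOuter K a w κ p q e) := by
  classical
  have hinj : Function.Injective e := IsInterval.injective ⟨_, he⟩
  have hone : ∀ (i : Fin m) (z : ℂ), (∏ r ∈ (Finset.univ.erase p).erase q,
      if HasColor w κ (e i) r then colorFactor K a w r z else 1) = 1 := by
    intro i z
    refine Finset.prod_eq_one fun r hr => if_neg ?_
    simp only [Finset.mem_erase] at hr
    exact not_hasColor_block hpq hm he hr.2.1 hr.1 i
  intro i j y
  rw [pairOuter, pairOuter]
  congr 1
  · rw [← Equiv.prod_comp (Equiv.swap (e i) (e j))]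
    refine Finset.prod_congr rfl fun l _ => ?_
    simp only [Function.comp_apply, Equiv.swap_apply_self]
    rcases eq_or_ne l (e i) with rfl | hi
    · rw [Equiv.swap_apply_left, hone, hone]
    rcases eq_or_ne l (e j) with rfl | hj
    · rw [Equiv.swap_apply_right, hone, hone]
    · rw [Equiv.swap_apply_of_ne_of_ne hi hj]
  · rw [← Equiv.prod_comp (Equiv.swap i j)]
    refine Finset.prod_congr rfl fun l _ => ?_
    simp only [Function.comp_apply, ← hinj.swap_apply, Equiv.swap_apply_self]

end Pair

lemma prod_Iio_comp_swap {M : Type*} [CommMonoid M] (f : Fin n → M) {r : Fin n} (hp : r ≠ p)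
    (hq : r ≠ q) :
    ∏ s ∈ Finset.Iio r, f (Equiv.swap p q s) = ∏ s ∈ Finset.Iio r, f s := by
  refine Finset.prod_equiv (Equiv.swap p q) (fun s => ?_) fun _ _ => rfl
  rw [Finset.mem_Iio, Finset.mem_Iio]
  conv_rhs => rw [← Equiv.swap_apply_of_ne_of_ne hp hq]
  exact (swap_lt_swap_iff_of_adjacent hpq (fun h => hq h.2) (fun h => hp h.2)).symm

@[to_additive]
lemma prod_Ioi_comp_swap {M : Type*} [CommMonoid M] (f : Fin n → M) {r : Fin n} (hp : r ≠ p)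
    (hq : r ≠ q) :
    ∏ s ∈ Finset.Ioi r, f (Equiv.swap p q s) = ∏ s ∈ Finset.Ioi r, f s := by
  refine Finset.prod_equiv (Equiv.swap p q) (fun s => ?_) fun _ _ => rfl
  rw [Finset.mem_Ioi, Finset.mem_Ioi]
  conv_rhs => rw [← Equiv.swap_apply_of_ne_of_ne hp hq]
  exact (swap_lt_swap_iff_of_adjacent hpq (fun h => hp h.1) (fun h => hq h.1)).symm

/-- The start of a block depends only on the number of variables of the pair as a whole. -/
lemma blockStart_mul_swap {κ' : Fin n → ℕ} (hκ : ∀ r, r ≠ p → r ≠ q → κ' (w r) = κ (w r))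
    (hsum : κ' (w p) + κ' (w q) = κ (w p) + κ (w q)) {r : Fin n} (hp : r ≠ p) :
    blockStart (w * Equiv.swap p q) κ' r = blockStart w κ r := by
  have hlt : p < q := by rw [Fin.lt_def]; omega
  rcases eq_or_ne r q with rfl | hq
  · refine Finset.sum_congr rfl fun s hs => ?_
    have hs := Finset.mem_Ioi.1 hs
    rw [Equiv.Perm.mul_apply, Equiv.swap_apply_of_ne_of_ne (hlt.trans hs).ne' hs.ne',
      hκ s (hlt.trans hs).ne' hs.ne']
  simp only [blockStart, Equiv.Perm.mul_apply]
  rw [sum_Ioi_comp_swap hpq (fun s => κ' (w s)) hp hq]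
  rcases lt_or_ge r p with h | h
  · have hmp : p ∈ Finset.Ioi r := Finset.mem_Ioi.2 h
    have hmq : q ∈ (Finset.Ioi r).erase p :=
      Finset.mem_erase.2 ⟨hlt.ne', Finset.mem_Ioi.2 (h.trans hlt)⟩
    rw [← Finset.add_sum_erase _ _ hmp, ← Finset.add_sum_erase _ _ hmq,
      ← Finset.add_sum_erase _ (fun s => κ (w s)) hmp,
      ← Finset.add_sum_erase _ (fun s => κ (w s)) hmq, ← add_assoc, ← add_assoc, hsum]
    congr 1
    refine Finset.sum_congr rfl fun s hs => ?_
    simp only [Finset.mem_erase] at hs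
    exact hκ s hs.2.1 hs.1
  · refine Finset.sum_congr rfl fun s hs => ?_
    have hs := Finset.mem_Ioi.1 hs
    have hps := lt_of_le_of_lt h hs
    refine hκ s hps.ne' ?_
    rintro rfl
    rw [Fin.lt_def] at hs
    rw [Fin.le_def] at h
    exact hp (Fin.ext (by omega))

lemma pairOuter_mul_swap {m : ℕ} (K a : Fin n → ℂ) {κ' : Fin n → ℕ}
    (hκ : ∀ r, r ≠ p → r ≠ q → κ' (w r) = κ (w r))
    (hsum : κ' (w p) + κ' (w q) = κ (w p) + κ (w q)) (e : Fin m → Fin k) :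
    pairOuter K a (w * Equiv.swap p q) κ' p q e = pairOuter K a w κ p q e := by
  classical
  have hlt : p < q := by rw [Fin.lt_def]; omega
  funext y
  rw [pairOuter, pairOuter]
  congr 1
  · refine Finset.prod_congr rfl fun i _ => Finset.prod_congr rfl fun r hr => ?_
    simp only [Finset.mem_erase] at hr
    have hcol : HasColor (w * Equiv.swap p q) κ' i r ↔ HasColor w κ i r := by
      rw [HasColor, HasColor, blockStart_mul_swap hpq hκ hsum hr.2.1, Equiv.Perm.mul_apply,
        Equiv.swap_apply_of_ne_of_ne hr.2.1 hr.1, hκ r hr.2.1 hr.1]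
    have hfac : colorFactor K a (w * Equiv.swap p q) r (y i) = colorFactor K a w r (y i) := by
      simp only [colorFactor, Equiv.Perm.mul_apply]
      rw [prod_Iio_comp_swap hpq (fun s => br (a (w s) / y i)) hr.2.1 hr.1,
        prod_Ioi_comp_swap hpq (fun s => br (K (w s) * a (w s) / y i)) hr.2.1 hr.1]
    rw [hfac, if_congr hcol rfl rfl]
  · refine Finset.prod_congr rfl fun i _ => ?_
    congr 1
    · refine Finset.prod_congr rfl fun s hs => ?_
      have hs := Finset.mem_Iio.1 hs
      rw [Equiv.Perm.mul_apply, Equiv.swap_apply_of_ne_of_ne hs.ne (hs.trans hlt).ne]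
    · refine Finset.prod_congr rfl fun s hs => ?_
      have hs := Finset.mem_Ioi.1 hs
      rw [Equiv.Perm.mul_apply, Equiv.swap_apply_of_ne_of_ne (hlt.trans hs).ne' hs.ne']

/-- Stable envelopes of adjacent chambers are related by the `R`-matrix of the two operators that
are exchanged. -/
lemma stab_eq_sum_Rmat_mul_stab {t : ℂ} (ht : 1 < ‖t‖) (K a : Fin n → ℂ) (ha : ∀ β, a β ≠ 0)
    {α β : Fin n} (hα : w p = α) (hβ : w q = β)
    (hu : ∀ z : ℤ, a β / a α ≠ t ^ z ∧ a β / a α ≠ K α * t ^ z) (hκ : ∑ γ, κ γ = k)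
    {x : Fin k → ℂ} (hx : Function.Injective x) (hx0 : ∀ i, x i ≠ 0) :
    stab t K a w κ x = ∑ l : Fin (κ α + κ β + 1),
      Rmat t (K α) (K β) (a β / a α) (κ α + κ β) ⟨κ α, by omega⟩ l *
        stab t K a (w * Equiv.swap p q)
          (Function.update (Function.update κ α (l : ℕ)) β (κ α + κ β - l)) x := by
  have hne : p ≠ q := by rintro rfl; omega
  have hαβ : α ≠ β := fun h => hne (w.injective (by rw [hα, hβ, h]))
  have hle : blockStart w κ q + (κ α + κ β) ≤ k := by
    have h₁ := blockStart_add_le_sum w κ p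
    rw [blockStart_adjacent hpq, hκ, hα, hβ] at h₁
    omega
  let e : Fin (κ α + κ β) → Fin k := fun i => ⟨blockStart w κ q + i, by omega⟩
  have he : ∀ i, (e i : ℕ) = blockStart w κ q + i := fun i => rfl
  have heI : IsInterval e := ⟨_, he⟩
  set F := pairOuter K a w κ p q e with hF
  have hFs : BlockSymmetric e F := blockSymmetric_pairOuter hpq (by rw [hα, hβ]) he K a
  -- The `R`-matrix is defined at the spectral parameters `(1, a_β/a_α)`, so the variables are
  -- rescaled by `a_α`.
  have hsymm : ∀ r u v, hlSymm t (fun y => F y * ∏ i, br (pairCoeff r u v i / y (e i))) x =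
      hlSymm t (fun y => F (fun i => a α * y i) *
        ∏ i, br (pairCoeff r (u / a α) (v / a α) i / y (e i))) (fun i => (a α)⁻¹ * x i) := by
    intro r u v
    rw [hlSymm_scale t _ x (ha α)]
    simp only [pairCoeff_div_mul]
  have h₁ : stab t K a w κ x = hlSymm t (fun y => F y *
      ∏ i, br (pairCoeff (κ β) (a α) (K β * a β) i / y (e i))) x :=
    Finset.sum_congr rfl fun σ _ => by
      rw [stabTerm_eq_pairOuter_mul hpq (by rw [hα, hβ]) he t K a, hα, hβ]
  have h₂ : ∀ l : Fin (κ α + κ β + 1), stab t K a (w * Equiv.swap p q)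
      (Function.update (Function.update κ α (l : ℕ)) β (κ α + κ β - l)) x = hlSymm t (fun y => F y *
      ∏ i, br (pairCoeff l (a β) (K α * a α) i / y (e i))) x := by
    intro l
    have hl := l.2
    set κ' := Function.update (Function.update κ α (l : ℕ)) β (κ α + κ β - l) with hκ'
    have hκα : κ' α = l := by simp [hκ', hαβ]
    have hκβ : κ' β = κ α + κ β - l := by simp [hκ']
    have hout : ∀ r, r ≠ p → r ≠ q → κ' (w r) = κ (w r) := by
      intro r hp hq
      have h₃ : w r ≠ α := fun h => hp (w.injective (h.trans hα.symm))
      have h₄ : w r ≠ β := fun h => hq (w.injective (h.trans hβ.symm))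
      simp [hκ', h₃, h₄]
    have hsum : κ' (w p) + κ' (w q) = κ (w p) + κ (w q) := by
      rw [hα, hβ]
      omega
    have hwp : (w * Equiv.swap p q) p = β := by simp [hβ]
    have hwq : (w * Equiv.swap p q) q = α := by simp [hα]
    refine Finset.sum_congr rfl fun σ _ => ?_
    rw [stabTerm_eq_pairOuter_mul (w := w * Equiv.swap p q) (κ := κ') hpq
      (m := κ α + κ β) (by rw [hwp, hwq]; omega) (e := e)
      (fun i => by rw [blockStart_mul_swap hpq hout hsum hne.symm]), hwp, hwq, hκα,
      pairOuter_mul_swap hpq K a hout hsum]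
  have hinj : Function.Injective fun i => (a α)⁻¹ * x i := fun i j h =>
    hx (mul_left_cancel₀ (inv_ne_zero (ha α)) h)
  have hFs' : BlockSymmetric e fun y => F fun i => a α * y i :=
    fun i j y => hFs i j fun i => a α * y i
  have hmain := hlSymm_eq_sum_Rmat (Kα := K α) (Kβ := K β) ht (div_ne_zero (ha β) (ha α)) hu
    ⟨κ α, by omega⟩ heI hFs' hinj (fun i => mul_ne_zero (inv_ne_zero (ha α)) (hx0 i))
  rw [h₁, hsymm, div_self (ha α), mul_div_assoc]
  simp only [h₂, hsymm, mul_div_assoc, div_self (ha α), mul_one]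
  rw [← hmain]
  have : κ α + κ β - κ α = κ β := by omega
  simp only [this]

end Adjacent

/-! ### Moving an operator around the cycle: pointwise identities -/

/-- The functional equation of `(y; q⁻¹)_∞`. -/
lemma one_sub_mul_qPoch {q : ℂ} (hq : 1 < ‖q‖) (y : ℂ) :
    (1 - y) * qPoch (y / q) q⁻¹ = qPoch y q⁻¹ := by
  have hr : ‖q⁻¹‖ < 1 := by rw [norm_inv]; exact inv_lt_one_of_one_lt₀ hq
  have hsum : Summable fun d : ℕ => -(y * q⁻¹ ^ (d + 1)) := by
    have h : Summable fun d : ℕ => q⁻¹ ^ (d + 1) :=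
      (summable_nat_add_iff 1).2 (summable_geometric_of_norm_lt_one hr)
    exact (h.mul_left y).neg
  have hmul : Multipliable fun d : ℕ => 1 - y * q⁻¹ ^ (d + 1) := by
    simpa only [sub_eq_add_neg] using Complex.multipliable_one_add_of_summable hsum
  have h := tprod_eq_zero_mul' (f := fun d : ℕ => 1 - y * q⁻¹ ^ d) hmul
  have e : ∀ d : ℕ, y * q⁻¹ ^ (d + 1) = y / q * q⁻¹ ^ d := fun d => by
    rw [pow_succ', div_eq_mul_inv, mul_assoc]
  simp only [e, pow_zero, mul_one] at h
  exact h.symm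

lemma br_ne_zero {y : ℂ} (h : y ≠ 1) : br y ≠ 0 := sub_ne_zero.2 h.symm

/-- The contribution to the integrand of two variables `a`, `b`, where `a` precedes `b`: two factors
of the principal part and one of the weight of the stable envelope. -/
def screenFactor (t q a b : ℂ) : ℂ :=
  qPoch (a / b) q⁻¹ / qPoch (t * (a / b)) q⁻¹ * (qPoch (b / a) q⁻¹ / qPoch (t * (b / a)) q⁻¹) *
    (br (t * (b / a)) / br (b / a))

lemma screenFactor_div_div {t q a b : ℂ} (hq : q ≠ 0) :
    screenFactor t q (a / q) (b / q) = screenFactor t q a b := by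
  simp only [screenFactor, div_div_div_cancel_right₀ hq]

/-- Shifting the first of two variables exchanges their order. -/
lemma screenFactor_div_left {t q a b : ℂ} (hq : 1 < ‖q‖) (ha : a ≠ 0) (hb : b ≠ 0)
    (h₁ : a ≠ b) (h₂ : b ≠ t * a) (h₃ : a ≠ q * b) (h₄ : a ≠ q * (t * b)) :
    screenFactor t q (a / q) b = screenFactor t q b a := by
  have hq0 : q ≠ 0 := by rintro rfl; simp at hq; linarith
  have e₁ : a / q / b = a / b / q := by rw [div_right_comm]
  have e₂ : b / (a / q) = q * (b / a) := by field_simp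
  have e₃ : t * (a / b / q) = t * (a / b) / q := by ring
  have n₁ : br (a / b) ≠ 0 := br_ne_zero fun h => h₁ ((div_eq_one_iff_eq hb).1 h)
  have n₂ : br (t * (a / b)) ≠ 0 := br_ne_zero fun h =>
    h₂ ((div_eq_one_iff_eq hb).1 (by rw [mul_div_assoc, h])).symm
  have n₃ : br (q * (b / a)) ≠ 0 := br_ne_zero fun h =>
    h₃ ((div_eq_one_iff_eq ha).1 (by rw [mul_div_assoc, h])).symm
  have n₄ : br (t * (q * (b / a))) ≠ 0 := br_ne_zero fun h =>
    h₄ ((div_eq_one_iff_eq ha).1 (by rw [← h]; ring)).symm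
  have p₁ := one_sub_mul_qPoch hq (a / b)
  have p₂ := one_sub_mul_qPoch hq (t * (a / b))
  have p₃ := one_sub_mul_qPoch hq (q * (b / a))
  have p₄ := one_sub_mul_qPoch hq (t * (q * (b / a)))
  rw [mul_div_cancel_left₀ _ hq0] at p₃
  rw [mul_left_comm, mul_div_cancel_left₀ _ hq0, mul_left_comm] at p₄
  rw [screenFactor, screenFactor, e₁, e₂, e₃, ← p₁, ← p₂, ← p₃, ← p₄]
  change _ / _ * (br (q * (b / a)) * _ / (br (t * (q * (b / a))) * _)) * _ =
    _ * (br (a / b) * _ / (br (t * (a / b)) * _)) * _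
  rw [mul_div_mul_comm, mul_div_mul_comm]
  generalize qPoch (a / b / q) q⁻¹ / qPoch (t * (a / b) / q) q⁻¹ = A
  generalize qPoch (b / a) q⁻¹ / qPoch (t * (b / a)) q⁻¹ = B
  generalize br (a / b) = b₁ at *
  generalize br (t * (a / b)) = b₂ at *
  generalize br (q * (b / a)) = b₃ at *
  generalize br (t * (q * (b / a))) = b₄ at *
  field_simp

/-- The contribution of a variable `z` and an operator with `a/z = y` to the principal part divided
by the denominator of the stable envelope. -/
def vertexFactor (K q y : ℂ) : ℂ := qPoch (K * y) q⁻¹ / qPoch y q⁻¹ / br (K * y)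

lemma vertexFactor_mul_br {K q y : ℂ} (hq : 1 < ‖q‖) (h₁ : br (K * (q * y)) ≠ 0)
    (h₂ : br (K * y) ≠ 0) (h₃ : br (q * y) ≠ 0) :
    vertexFactor K q (q * y) * br (q * y) = vertexFactor K q y * br (K * y) := by
  have hq0 : q ≠ 0 := by rintro rfl; simp at hq; linarith
  have p₁ := one_sub_mul_qPoch hq (K * (q * y))
  have p₂ := one_sub_mul_qPoch hq (q * y)
  rw [mul_div_cancel_left₀ _ hq0] at p₂
  rw [mul_left_comm, mul_div_cancel_left₀ _ hq0, mul_left_comm] at p₁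
  rw [vertexFactor, vertexFactor, ← p₁, ← p₂, div_mul_cancel₀ _ h₂]
  change br (K * (q * y)) * _ / (br (q * y) * _) / _ * _ = _
  rw [mul_div_mul_comm]
  generalize qPoch (K * y) q⁻¹ / qPoch y q⁻¹ = A
  generalize br (K * (q * y)) = b₁ at *
  generalize br (q * y) = b₂ at *
  field_simp

section Color

variable {N k : ℕ}

lemma HasColor.unique {n : ℕ} {w : Equiv.Perm (Fin n)} {κ : Fin n → ℕ} {i : Fin k} {p r : Fin n}
    (hp : HasColor w κ i p) (hr : HasColor w κ i r) : p = r := by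
  obtain ⟨h₁, h₂⟩ := hp
  obtain ⟨h₃, h₄⟩ := hr
  rcases lt_trichotomy p r with h | h | h
  · have := blockStart_add_le_of_lt w κ h
    omega
  · exact h
  · have := blockStart_add_le_of_lt w κ h
    omega

open scoped Classical in
lemma HasColor.prod_ite {n : ℕ} {w : Equiv.Perm (Fin n)} {κ : Fin n → ℕ} {i : Fin k} {p : Fin n}
    (hp : HasColor w κ i p) (f : Fin n → ℂ) :
    (∏ r, if HasColor w κ i r then f r else 1) = f p := by
  rw [Finset.prod_eq_single p, if_pos hp]
  · exact fun r _ hr => if_neg fun h => hr (h.unique hp)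
  · simp

variable {w : Equiv.Perm (Fin (N + 1))} {κ : Fin (N + 1) → ℕ}

lemma blockStart_last : blockStart w κ (Fin.last N) = 0 :=
  Finset.sum_eq_zero fun i hi => absurd (Finset.mem_Ioi.1 hi) (Fin.le_last i).not_gt

lemma blockStart_zero_add : blockStart w κ 0 + κ (w 0) = ∑ α, κ α := by
  rw [blockStart, Fin.Ioi_zero_eq_map, Finset.sum_map, ← Equiv.sum_comp w, Fin.sum_univ_succ,
    add_comm]
  rfl

lemma exists_hasColor (hκ : ∑ α, κ α = k) (i : Fin k) : ∃ p, HasColor w κ i p := by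
  obtain ⟨p, hp, hmin⟩ := Finset.exists_min_image
    (Finset.univ.filter fun p => blockStart w κ p ≤ (i : ℕ)) id
    ⟨Fin.last N, by simp [blockStart_last]⟩
  have hp' := (Finset.mem_filter.1 hp).2
  refine ⟨p, hp', ?_⟩
  induction p using Fin.cases with
  | zero =>
    rw [blockStart_zero_add, hκ]
    exact i.2
  | succ p =>
    by_contra h
    rw [← blockStart_adjacent (p := p.castSucc) (q := p.succ) (by simp)] at h
    have := hmin p.castSucc (Finset.mem_filter.2 ⟨Finset.mem_univ _, not_lt.1 h⟩)
    exact absurd this (not_le.2 Fin.castSucc_lt_succ)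

@[to_additive]
lemma prod_Ioi_castSucc {M : Type*} [CommMonoid M] (f : Fin (N + 1) → M) (r : Fin N) :
    ∏ s ∈ Finset.Ioi r.castSucc, f s = f (Fin.last N) * ∏ s ∈ Finset.Ioi r, f s.castSucc := by
  have h : Finset.Ioi r.castSucc =
      insert (Fin.last N) ((Finset.Ioi r).map Fin.castSuccEmb) := by
    rw [Fin.map_castSuccEmb_Ioi]
    ext i
    have := Fin.castSucc_lt_last r
    simp only [Finset.mem_Ioi, Finset.mem_insert, Finset.mem_Ioo]
    rcases eq_or_ne i (Fin.last N) with rfl | hi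
    · simp
    · simp [hi, Fin.lt_last_iff_ne_last]
  rw [h, Finset.prod_insert, Finset.prod_map]
  · rfl
  · simp

lemma prod_Iio_succ {M : Type*} [CommMonoid M] (f : Fin (N + 1) → M) (r : Fin N) :
    ∏ s ∈ Finset.Iio r.succ, f s = f 0 * ∏ s ∈ Finset.Iio r, f s.succ := by
  have h : Finset.Iio r.succ = insert 0 ((Finset.Iio r).map (Fin.succEmb N)) := by
    rw [Fin.map_succEmb_Iio]
    ext i
    simp only [Finset.mem_Iio, Finset.mem_insert, Finset.mem_Ioo]
    rcases eq_or_ne i 0 with rfl | hi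
    · simp
    · simp [hi, Fin.pos_iff_ne_zero]
  rw [h, Finset.prod_insert, Finset.prod_map]
  · rfl
  · simp

lemma blockStart_castSucc (r : Fin N) :
    blockStart w κ r.castSucc = κ (w (Fin.last N)) + ∑ s ∈ Finset.Ioi r, κ (w s.castSucc) :=
  sum_Ioi_castSucc (fun s => κ (w s)) r

lemma blockStart_succ (r : Fin N) :
    blockStart w κ r.succ = ∑ s ∈ Finset.Ioi r, κ (w s.succ) := by
  rw [blockStart, Fin.Ioi_succ, Finset.sum_map]
  rfl

end Color

/-- The rotation `i ↦ i + c` of `Fin k`. Composing with it moves the first `c` variables behind all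
others. -/
def rotation (k c : ℕ) (hc : c ≤ k) : Equiv.Perm (Fin k) where
  toFun i := ⟨if (i : ℕ) + c < k then i + c else i + c - k, by split_ifs <;> omega⟩
  invFun i := ⟨if (i : ℕ) < c then i + k - c else i - c, by split_ifs <;> omega⟩
  left_inv i := by
    ext
    simp only
    split_ifs <;> omega
  right_inv i := by
    ext
    simp only
    split_ifs <;> omega

lemma rotation_symm_val {k c : ℕ} (hc : c ≤ k) (i : Fin k) :
    ((rotation k c hc).symm i : ℕ) = if (i : ℕ) < c then i + k - c else i - c := rfl

/-- Shifting the first `c` variables has the same effect on the factors of the pairs of variables as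
moving them behind all others. -/
lemma prod_screenFactor_shift {k c : ℕ} (hc : c ≤ k) {t q : ℂ} (hq : 1 < ‖q‖) {x : Fin k → ℂ}
    (hx0 : ∀ i, x i ≠ 0)
    (hx : ∀ m : ℤ, ∀ i j, i ≠ j → x i ≠ q ^ m * x j ∧ x i ≠ q ^ m * (t * x j)) :
    (∏ i : Fin k, ∏ j : Fin k, if i < j then
      screenFactor t q (if (i : ℕ) < c then x i / q else x i)
        (if (j : ℕ) < c then x j / q else x j) else 1) =
    ∏ i : Fin k, ∏ j : Fin k, if i < j then
      screenFactor t q (x (rotation k c hc i)) (x (rotation k c hc j)) else 1 := by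
  have hq0 : q ≠ 0 := by rintro rfl; simp at hq; linarith
  set ρ := rotation k c hc with hρ
  have hR : (∏ i : Fin k, ∏ j : Fin k, if i < j then screenFactor t q (x (ρ i)) (x (ρ j)) else 1) =
      ∏ i : Fin k, ∏ j : Fin k, if ρ.symm i < ρ.symm j then screenFactor t q (x i) (x j) else 1 := by
    rw [← Equiv.prod_comp ρ (fun i => ∏ j : Fin k,
      if ρ.symm i < ρ.symm j then screenFactor t q (x i) (x j) else 1)]
    refine Finset.prod_congr rfl fun i _ => ?_
    rw [← Equiv.prod_comp ρ (fun j =>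
      if ρ.symm (ρ i) < ρ.symm j then screenFactor t q (x (ρ i)) (x j) else 1)]
    simp only [Equiv.symm_apply_apply]
  -- Pairs on the same side keep their order; the other pairs are exchanged.
  let A : Fin k → Fin k → ℂ := fun i j =>
    if i < j ∧ ((i : ℕ) < c ↔ (j : ℕ) < c) then screenFactor t q (x i) (x j) else 1
  let B : Fin k → Fin k → ℂ := fun i j =>
    if (j : ℕ) < c ∧ ¬(i : ℕ) < c then screenFactor t q (x i) (x j) else 1
  have hL : ∀ i j : Fin k, (if i < j then
      screenFactor t q (if (i : ℕ) < c then x i / q else x i)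
        (if (j : ℕ) < c then x j / q else x j) else 1) = A i j * B j i := by
    intro i j
    simp only [A, B]
    by_cases hi : (i : ℕ) < c <;> by_cases hj : (j : ℕ) < c
    · simp [hi, hj, screenFactor_div_div hq0]
    · have hij : i < j := by rw [Fin.lt_def]; omega
      have h₀ := hx 0 i j hij.ne
      have h₁ := hx 1 i j hij.ne
      have h₂ := hx 0 j i hij.ne'
      simp only [zpow_zero, one_mul, zpow_one] at h₀ h₁ h₂
      simp [hi, hj, hij, screenFactor_div_left hq (hx0 i) (hx0 j) h₀.1 h₂.2 h₁.1 h₁.2]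
    · have hij : ¬i < j := by rw [Fin.lt_def]; omega
      simp [hi, hj, hij]
    · simp [hi, hj]
  have hRf : ∀ i j : Fin k,
      (if ρ.symm i < ρ.symm j then screenFactor t q (x i) (x j) else 1) = A i j * B i j := by
    intro i j
    simp only [A, B, Fin.lt_def, hρ, rotation_symm_val]
    have hi' := i.2
    have hj' := j.2
    by_cases hi : (i : ℕ) < c <;> by_cases hj : (j : ℕ) < c <;>
      simp only [hi, hj, if_true, if_false]
    · simp [show ((i : ℕ) + k - c < j + k - c) ↔ (i : ℕ) < j by omega]
    · simp [show ¬((i : ℕ) + k - c < j - c) by omega]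
    · simp [show ((i : ℕ) - c < j + k - c) by omega]
    · simp [show ((i : ℕ) - c < j - c) ↔ (i : ℕ) < j by omega]
  rw [hR]
  simp only [hL, hRf, Finset.prod_mul_distrib]
  congr 1
  exact Finset.prod_comm

open scoped Classical in
/-- The contribution to the integrand of the `i`-th variable `z` and all operators. -/
def matterFactor {n k : ℕ} (q : ℂ) (K a : Fin n → ℂ) (w : Equiv.Perm (Fin n)) (κ : Fin n → ℕ)
    (i : Fin k) (z : ℂ) : ℂ :=
  (∏ β, vertexFactor (K β) q (a β / z)) *
    ∏ r, if HasColor w κ i r then colorFactor K a w r z else 1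

/-- The operator `α` is moved from the first position of the chamber `w₁` to the last position of
the chamber `w₂`, while `a_α` and the variables attached to `α` are shifted. -/
lemma matterFactor_shift {N k : ℕ} {q : ℂ} (hq : 1 < ‖q‖) {K a : Fin (N + 1) → ℂ}
    {w₁ w₂ : Equiv.Perm (Fin (N + 1))} {α : Fin (N + 1)} (h₁₀ : w₁ 0 = α)
    (h₁ : ∀ r : Fin N, w₁ r.succ = α.succAbove r) (h₂₀ : w₂ (Fin.last N) = α)
    (h₂ : ∀ r : Fin N, w₂ r.castSucc = α.succAbove r) {κ : Fin (N + 1) → ℕ} (hκ : ∑ β, κ β = k)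
    (hc : κ α ≤ k) (i : Fin k) {z : ℂ} (hz0 : z ≠ 0)
    (hz : ∀ m : ℤ, ∀ β, z ≠ q ^ m * a β ∧ z ≠ q ^ m * (K β * a β)) :
    matterFactor q K (Function.update a α (a α / q)) w₂ κ i (if (i : ℕ) < κ α then z / q else z) =
      matterFactor q K a w₁ κ ((rotation k (κ α) hc).symm i) z := by
  classical
  have hq0 : q ≠ 0 := by rintro rfl; simp at hq; linarith
  have hbr : ∀ c, z ≠ c → br (c / z) ≠ 0 := fun c h =>
    br_ne_zero fun h' => h ((div_eq_one_iff_eq hz0).1 h').symm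
  have hne : ∀ r : Fin N, α.succAbove r ≠ α := fun r => Fin.succAbove_ne α r
  have hstep : ∀ β (m : ℤ), vertexFactor (K β) q (q ^ (m + 1) * a β / z) *
        br (q ^ (m + 1) * a β / z) =
      vertexFactor (K β) q (q ^ m * a β / z) * br (K β * (q ^ m * a β / z)) := by
    intro β m
    have e : q ^ (m + 1) * a β / z = q * (q ^ m * a β / z) := by
      rw [zpow_add_one₀ hq0]; ring
    have e₁ : K β * (q * (q ^ m * a β / z)) = q ^ (m + 1) * (K β * a β) / z := by
      rw [zpow_add_one₀ hq0]; ring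
    have e₂ : K β * (q ^ m * a β / z) = q ^ m * (K β * a β) / z := by ring
    rw [e]
    refine vertexFactor_mul_br hq ?_ ?_ ?_
    · rw [e₁]; exact hbr _ (hz _ β).2
    · rw [e₂]; exact hbr _ (hz _ β).2
    · rw [← e]; exact hbr _ (hz _ β).1
  rw [matterFactor, matterFactor, Fin.prod_univ_succAbove _ α,
    Fin.prod_univ_succAbove (fun β => vertexFactor (K β) q (a β / z)) α]
  simp only [Function.update_self, Function.update_of_ne (hne _)]
  by_cases hi : (i : ℕ) < κ α
  -- The variable is attached to `α`: the factors of the other operators change.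
  · have hcol₂ : HasColor w₂ κ i (Fin.last N) := by
      rw [HasColor, blockStart_last, h₂₀]
      omega
    have hcol₁ : HasColor w₁ κ ((rotation k (κ α) hc).symm i) 0 := by
      have h := blockStart_zero_add (w := w₁) (κ := κ)
      rw [h₁₀, hκ] at h
      rw [HasColor, rotation_symm_val, if_pos hi, h₁₀]
      omega
    rw [hcol₁.prod_ite, hcol₂.prod_ite, if_pos hi]
    simp only [colorFactor, Fin.Iio_last_eq_map, Fin.Ioi_zero_eq_map, Finset.prod_map,
      Fin.coe_castSuccEmb, Fin.coe_succEmb, h₁, h₂, Function.update_of_ne (hne _)]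
    rw [div_div_div_cancel_right₀ hq0]
    have hI : Finset.Ioi (Fin.last N) = ∅ := by ext; simp [Fin.le_last]
    have hI' : Finset.Iio (0 : Fin (N + 1)) = ∅ := by ext; simp
    rw [hI, hI', Finset.prod_empty, Finset.prod_empty, mul_one, one_mul, mul_assoc, mul_assoc,
      ← Finset.prod_mul_distrib, ← Finset.prod_mul_distrib]
    congr 1
    refine Finset.prod_congr rfl fun r _ => ?_
    have := hstep (α.succAbove r) 0
    rw [zero_add, zpow_one, zpow_zero, one_mul] at this
    rw [div_div_eq_mul_div, mul_comm _ q, this, mul_div_assoc]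
  -- The variable is attached to another operator: only the factor of `α` changes.
  · obtain ⟨p, hp⟩ := exists_hasColor (w := w₂) hκ i
    induction p using Fin.lastCases with
    | last =>
      rw [HasColor, blockStart_last, h₂₀] at hp
      omega
    | cast r =>
      have hcol₁ : HasColor w₁ κ ((rotation k (κ α) hc).symm i) r.succ := by
        rw [HasColor, blockStart_castSucc, h₂₀] at hp
        simp only [h₂] at hp
        rw [HasColor, rotation_symm_val, if_neg hi, blockStart_succ]
        simp only [h₁]
        omega
      rw [hcol₁.prod_ite, hp.prod_ite, if_neg hi, colorFactor, colorFactor, prod_Ioi_castSucc,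
        prod_Iio_succ, ← Fin.map_castSuccEmb_Iio, Fin.Ioi_succ, Finset.prod_map, Finset.prod_map]
      simp only [Fin.coe_castSuccEmb, Fin.coe_succEmb, h₁, h₂, h₁₀, h₂₀,
        Function.update_of_ne (hne _), Function.update_self]
      have := hstep α (-1)
      rw [neg_add_cancel, zpow_zero, one_mul, zpow_neg_one, inv_mul_eq_div] at this
      rw [mul_div_assoc (K α)]
      linear_combination -(∏ r, vertexFactor (K (α.succAbove r)) q (a (α.succAbove r) / z)) *
        (∏ s ∈ Finset.Iio r, br (a (α.succAbove s) / z)) *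
        (∏ s ∈ Finset.Ioi r, br (K (α.succAbove s) * a (α.succAbove s) / z)) * this

/-! ### Moving an operator around the cycle: the integrand -/

section Integrand

variable {n k : ℕ} (P : Params n)

/-- The point `x = exp lam` avoids the divisors `x_i = q₂^m a_α`, `x_i = q₂^m K_α a_α`,
`x_i = q₂^m x_j`, `x_i = q₂^m q₁ x_j`. -/
def IsRegularPoint (A : Fin n → ℂ) (lam : Fin k → ℂ) : Prop :=
  ∀ m : ℤ,
    (∀ i α, vars lam i ≠ P.q₂ ^ m * spec A α ∧ vars lam i ≠ P.q₂ ^ m * (P.K α * spec A α)) ∧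
    (∀ i j, i ≠ j → vars lam i ≠ P.q₂ ^ m * vars lam j ∧
      vars lam i ≠ P.q₂ ^ m * (P.q₁ * vars lam j))

lemma vars_ne_zero (lam : Fin k → ℂ) (i : Fin k) : vars lam i ≠ 0 := Complex.exp_ne_zero _

lemma spec_ne_zero (A : Fin n → ℂ) (α : Fin n) : spec A α ≠ 0 := Complex.exp_ne_zero _

variable {P} in
lemma IsRegularPoint.injective {A : Fin n → ℂ} {lam : Fin k → ℂ} (h : IsRegularPoint P A lam) :
    Function.Injective (vars lam) := by
  intro i j hij
  by_contra hne
  exact ((h 0).2 i j hne).1 (by simpa using hij)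

variable {P} in
lemma IsRegularPoint.comp {A : Fin n → ℂ} {lam : Fin k → ℂ} (h : IsRegularPoint P A lam)
    (σ : Equiv.Perm (Fin k)) : IsRegularPoint P A (lam ∘ σ) := fun m =>
  ⟨fun i α => (h m).1 (σ i) α, fun i j hij => (h m).2 (σ i) (σ j) fun h => hij (σ.injective h)⟩

lemma spec_shiftSpec (A : Fin n → ℂ) (α : Fin n) :
    spec (shiftSpec P A α) = Function.update (spec A) α (spec A α / P.q₂) := by
  funext β
  rcases eq_or_ne β α with rfl | h
  · simp [spec, shiftSpec, Params.q₂, Complex.exp_sub]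
  · simp [spec, shiftSpec, h]

variable {P} in
lemma IsRegularPoint.shiftSpec {A : Fin n → ℂ} {lam : Fin k → ℂ} (h : IsRegularPoint P A lam)
    (α : Fin n) : IsRegularPoint P (shiftSpec P A α) lam := by
  refine fun m => ⟨fun i β => ?_, (h m).2⟩
  rw [spec_shiftSpec]
  rcases eq_or_ne β α with rfl | hβ
  · have hq : P.q₂ ≠ 0 := Complex.exp_ne_zero _
    have := (h (m - 1)).1 i β
    rw [zpow_sub_one₀ hq] at this
    rw [Function.update_self]
    refine ⟨fun h => this.1 (h.trans ?_), fun h => this.2 (h.trans ?_)⟩ <;> ring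
  · rw [Function.update_of_ne hβ]
    exact (h m).1 i β

lemma vars_shiftVars (S : Finset (Fin k)) (lam : Fin k → ℂ) (i : Fin k) :
    vars (shiftVars P S lam) i = if i ∈ S then vars lam i / P.q₂ else vars lam i := by
  rw [vars, shiftVars]
  split_ifs
  · rw [Complex.exp_sub]; rfl
  · rfl

lemma prod_erase_eq_prod_ite (f : Fin k → Fin k → ℂ) :
    ∏ i, ∏ j ∈ Finset.univ.erase i, f i j = ∏ i, ∏ j, if i < j then f i j * f j i else 1 := by
  have h : ∀ i, ∏ j ∈ Finset.univ.erase i, f i j =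
      (∏ j, if i < j then f i j else 1) * ∏ j, if j < i then f i j else 1 := by
    intro i
    rw [← Finset.prod_mul_distrib, ← Finset.mul_prod_erase _ _ (Finset.mem_univ i)]
    simp only [lt_irrefl, if_false, one_mul]
    refine Finset.prod_congr rfl fun j hj => ?_
    rcases lt_or_gt_of_ne (Finset.ne_of_mem_erase hj) with h | h
    · rw [if_neg h.not_gt, if_pos h, one_mul]
    · rw [if_pos h, if_neg h.not_gt, mul_one]
  simp only [h, Finset.prod_mul_distrib]
  rw [Finset.prod_comm (f := fun i j => if j < i then f i j else 1)]
  simp only [← Finset.prod_mul_distrib]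
  refine Finset.prod_congr rfl fun i _ => Finset.prod_congr rfl fun j _ => ?_
  split_ifs <;> simp

/-- The integrand as a product over pairs of variables and over single variables. -/
lemma summand_one_eq (A : Fin n → ℂ) (w : Equiv.Perm (Fin n)) (κ : Fin n → ℕ) (lam : Fin k → ℂ) :
    summand P A w κ 1 lam = Complex.exp (-P.s * ∑ i, lam i) *
      (∏ i, ∏ j, if i < j then screenFactor P.q₁ P.q₂ (vars lam i) (vars lam j) else 1) *
      ∏ i, matterFactor P.q₂ P.K (spec A) w κ i (vars lam i) := by
  classical
  rw [summand, principal, stabTerm_eq, hlWeight, prod_Ioi_eq_prod_ite, stabDenom,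
    prod_erase_eq_prod_ite]
  have h₁ : ∀ i j : Fin k, (if i < j then
      screenFactor P.q₁ P.q₂ (vars lam i) (vars lam j) else 1) =
      (if i < j then
        qPoch (vars lam i / vars lam j) P.q₂⁻¹ / qPoch (P.q₁ * (vars lam i / vars lam j)) P.q₂⁻¹ *
        (qPoch (vars lam j / vars lam i) P.q₂⁻¹ / qPoch (P.q₁ * (vars lam j / vars lam i)) P.q₂⁻¹)
        else 1) *
      (if i < j then br (P.q₁ * (vars lam j / vars lam i)) / br (vars lam j / vars lam i)
        else 1) := by
    intro i j
    split_ifs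
    · rfl
    · rw [one_mul]
  simp only [h₁, matterFactor, vertexFactor, Finset.prod_mul_distrib, Finset.prod_div_distrib,
    ← mul_div_assoc, Equiv.Perm.coe_one, Function.comp_id]
  ring

lemma principal_comp (A : Fin n → ℂ) (lam : Fin k → ℂ) (σ : Equiv.Perm (Fin k)) :
    principal P A (lam ∘ σ) = principal P A lam := by
  simp only [principal]
  congr 1
  · congr 1
    · exact congrArg (fun z => Complex.exp (-P.s * z)) (Equiv.sum_comp σ lam)
    · refine Fintype.prod_equiv σ _ _ fun i => Finset.prod_equiv σ (fun j => ?_) fun j _ => rfl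
      simp
  · exact Fintype.prod_equiv σ _ _ fun i => rfl

lemma stabDenom_comp (A : Fin n → ℂ) (lam : Fin k → ℂ) (σ : Equiv.Perm (Fin k)) :
    stabDenom P A (lam ∘ σ) = stabDenom P A lam :=
  Fintype.prod_equiv σ _ _ fun _ => rfl

lemma summand_eq_summand_one (A : Fin n → ℂ) (w : Equiv.Perm (Fin n)) (κ : Fin n → ℕ)
    (σ : Equiv.Perm (Fin k)) (lam : Fin k → ℂ) :
    summand P A w κ σ lam = summand P A w κ 1 (lam ∘ σ) := by
  rw [summand, summand, principal_comp, stabDenom_comp]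
  rfl

lemma shiftVars_map_comp (S : Finset (Fin k)) (lam : Fin k → ℂ) (σ : Equiv.Perm (Fin k)) :
    shiftVars P (S.map σ.toEmbedding) lam ∘ σ = shiftVars P S (lam ∘ σ) := by
  funext i
  simp [shiftVars]

/-- Shifting `a_α` and the variables attached to `α` moves `α` from the last position of the
chamber `w₂` to the first position of the chamber `w₁`, up to the power of `z` that comes from the
powers of the shifted variables. -/
lemma summand_shift {N : ℕ} (P : Params (N + 1)) (hq₂ : 1 < ‖P.q₂‖)
    {w₁ w₂ : Equiv.Perm (Fin (N + 1))} {α : Fin (N + 1)} (h₁₀ : w₁ 0 = α)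
    (h₁ : ∀ r : Fin N, w₁ r.succ = α.succAbove r) (h₂₀ : w₂ (Fin.last N) = α)
    (h₂ : ∀ r : Fin N, w₂ r.castSucc = α.succAbove r) {κ : Fin (N + 1) → ℕ} (hκ : ∑ β, κ β = k)
    (hc : κ α ≤ k) (A : Fin (N + 1) → ℂ) (σ : Equiv.Perm (Fin k)) {lam : Fin k → ℂ}
    (hlam : IsRegularPoint P A lam) :
    summand P (shiftSpec P A α) w₂ κ σ
        (shiftVars P ((initialSet k (κ α)).map σ.toEmbedding) lam) =
      Complex.exp (-P.logz * κ α) * summand P A w₁ κ (σ * rotation k (κ α) hc) lam := by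
  have hlog : P.logq₂ ≠ 0 := by
    intro h
    rw [Params.q₂, h] at hq₂
    simp at hq₂
  rw [summand_eq_summand_one, summand_eq_summand_one P A, shiftVars_map_comp]
  change _ = _ * summand P A w₁ κ 1 ((lam ∘ σ) ∘ rotation k (κ α) hc)
  have hmu := hlam.comp σ
  generalize lam ∘ σ = mu at hmu
  rw [summand_one_eq, summand_one_eq]
  have hmem : ∀ i : Fin k, i ∈ initialSet k (κ α) ↔ (i : ℕ) < κ α := by simp [initialSet]
  simp only [vars_shiftVars, hmem, spec_shiftSpec]
  rw [prod_screenFactor_shift hc hq₂ (vars_ne_zero mu) (fun m i j hij => (hmu m).2 i j hij)]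
  have hmat : ∏ i : Fin k, matterFactor P.q₂ P.K (Function.update (spec A) α (spec A α / P.q₂)) w₂
        κ i (if (i : ℕ) < κ α then vars mu i / P.q₂ else vars mu i) =
      ∏ i : Fin k, matterFactor P.q₂ P.K (spec A) w₁ κ i (vars (mu ∘ rotation k (κ α) hc) i) := by
    rw [Finset.prod_congr rfl fun i _ => matterFactor_shift hq₂ h₁₀ h₁ h₂₀ h₂ hκ hc i
      (vars_ne_zero mu i) fun m β => (hmu m).1 i β, ← Equiv.prod_comp (rotation k (κ α) hc)]
    simp only [Equiv.symm_apply_apply]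
    rfl
  have hexp : Complex.exp (-P.s * ∑ i, shiftVars P (initialSet k (κ α)) mu i) =
      Complex.exp (-P.logz * κ α) *
        Complex.exp (-P.s * ∑ i, (mu ∘ rotation k (κ α) hc) i) := by
    have hs : ∑ i, shiftVars P (initialSet k (κ α)) mu i = ∑ i, mu i - κ α * P.logq₂ := by
      have h : ∀ i, shiftVars P (initialSet k (κ α)) mu i =
          mu i - if i ∈ initialSet k (κ α) then P.logq₂ else 0 := by
        intro i
        rw [shiftVars]
        split_ifs
        · rfl
        · rw [sub_zero]
      simp only [h, Finset.sum_sub_distrib, Finset.sum_ite_mem, Finset.univ_inter,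
        Finset.sum_const, card_initialSet hc, nsmul_eq_mul]
    have hρ : ∑ i, (mu ∘ rotation k (κ α) hc) i = ∑ i, mu i := Equiv.sum_comp _ mu
    rw [hs, hρ, ← Complex.exp_add, Params.s]
    congr 1
    field_simp
    ring
  rw [hmat, hexp]
  simp only [mul_assoc]
  rfl

end Integrand

/-! ### Contour integrals -/

namespace Contour

variable {k : ℕ} (γ : Contour k)

lemma integral_congr {f g : (Fin k → ℂ) → ℂ}
    (h : ∀ j, ∀ᵐ t ∂(volume.restrict (Set.Icc (0 : Fin k → ℝ) 1)),
      f (γ.cube j t) = g (γ.cube j t)) : γ.integral f = γ.integral g := by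
  refine tsum_congr fun j => integral_congr_ae ?_
  filter_upwards [h j] with t ht
  rw [pullback, pullback, ht]

lemma integral_const_mul (c : ℂ) (f : (Fin k → ℂ) → ℂ) :
    γ.integral (fun lam => c * f lam) = c * γ.integral f := by
  simp only [integral, pullback, mul_assoc, MeasureTheory.integral_const_mul, tsum_mul_left]

variable {γ}

lemma Converges.const_mul {f : (Fin k → ℂ) → ℂ} (hf : γ.Converges f) (c : ℂ) :
    γ.Converges fun lam => c * f lam := by
  have h : ∀ j, γ.pullback (fun lam => c * f lam) j = fun t => c * γ.pullback f j t := by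
    intro j
    funext t
    simp only [pullback, mul_assoc]
  refine ⟨fun j => ?_, ?_⟩
  · rw [h]
    exact (hf.1 j).const_mul c
  · simp only [h, MeasureTheory.integral_const_mul]
    exact hf.2.mul_left c

lemma pullback_sum {ι : Type*} (s : Finset ι) (f : ι → (Fin k → ℂ) → ℂ) (j : γ.ι) :
    γ.pullback (fun lam => ∑ i ∈ s, f i lam) j = fun t => ∑ i ∈ s, γ.pullback (f i) j t := by
  funext t
  simp only [pullback, Finset.sum_mul]

lemma Converges.sum {ι : Type*} {s : Finset ι} {f : ι → (Fin k → ℂ) → ℂ}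
    (hf : ∀ i ∈ s, γ.Converges (f i)) : γ.Converges fun lam => ∑ i ∈ s, f i lam := by
  refine ⟨fun j => ?_, ?_⟩
  · rw [pullback_sum]
    exact integrable_finsetSum s fun i hi => (hf i hi).1 j
  · refine (summable_sum fun i hi => (hf i hi).2).congr fun j => ?_
    rw [pullback_sum, integral_finsetSum s fun i hi => (hf i hi).1 j]

lemma integral_sum {ι : Type*} {s : Finset ι} {f : ι → (Fin k → ℂ) → ℂ}
    (hf : ∀ i ∈ s, γ.Converges (f i)) :
    γ.integral (fun lam => ∑ i ∈ s, f i lam) = ∑ i ∈ s, γ.integral (f i) := by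
  rw [integral, tsum_congr fun j => by
    rw [pullback_sum, integral_finsetSum s fun i hi => (hf i hi).1 j]]
  exact Summable.tsum_finsetSum fun i hi => (hf i hi).2

end Contour

/-! ### The block in different chambers -/

section Chambers

variable {n k : ℕ} {P : Params n} {γ : Contour k} {A : Fin n → ℂ}

/-- The integrand of the component `κ` of the block. -/
def blockIntegrand (P : Params n) (A : Fin n → ℂ) (w : Equiv.Perm (Fin n)) (κ : Fin n → ℕ)
    (lam : Fin k → ℂ) : ℂ :=
  principal P A lam * (stab P.q₁ P.K (spec A) w κ (vars lam) / stabDenom P A lam)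

lemma blockIntegrand_eq_sum (P : Params n) (A : Fin n → ℂ) (w : Equiv.Perm (Fin n))
    (κ : Fin n → ℕ) : (blockIntegrand P A w κ : (Fin k → ℂ) → ℂ) =
      fun lam => ∑ σ : Equiv.Perm (Fin k), summand P A w κ σ lam := by
  funext lam
  simp only [blockIntegrand, stab, summand, Finset.sum_div, Finset.mul_sum]

lemma IsAdmissible.converges (hγ : IsAdmissible P γ A) (w : Equiv.Perm (Fin n)) {κ : Fin n → ℕ}
    (hκ : ∑ α, κ α = k) : γ.Converges (blockIntegrand P A w κ) := by
  rw [blockIntegrand_eq_sum]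
  exact Contour.Converges.sum fun σ _ => (hγ w κ hκ σ).1

lemma IsAdmissible.integral_eq_sum (hγ : IsAdmissible P γ A) (w : Equiv.Perm (Fin n))
    {κ : Fin n → ℕ} (hκ : ∑ α, κ α = k) :
    γ.integral (blockIntegrand P A w κ) =
      ∑ σ : Equiv.Perm (Fin k), γ.integral (summand P A w κ σ) := by
  rw [blockIntegrand_eq_sum]
  exact Contour.integral_sum fun σ _ => (hγ w κ hκ σ).1

lemma block_of_sum_eq (w : Equiv.Perm (Fin n)) {κ : Fin n → ℕ} (hκ : ∑ α, κ α = k) :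
    block P γ w A κ = 1 / (k.factorial : ℂ) * Complex.exp (P.s * ∑ α, P.μ α / 2 * A α) *
      γ.integral (blockIntegrand P A w κ) :=
  if_pos hκ

lemma block_of_sum_ne (w : Equiv.Perm (Fin n)) {κ : Fin n → ℕ} (hκ : ∑ α, κ α ≠ k) :
    block P γ w A κ = 0 :=
  if_neg hκ

lemma sum_update_pair {α β : Fin n} (hαβ : α ≠ β) (κ : Fin n → ℕ) {l : ℕ} (hl : l ≤ κ α + κ β) :
    ∑ δ, Function.update (Function.update κ α l) β (κ α + κ β - l) δ = ∑ δ, κ δ := by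
  have hβ : β ∈ Finset.univ.erase α := by simp [hαβ.symm]
  rw [← Finset.add_sum_erase _ _ (Finset.mem_univ α), ← Finset.add_sum_erase _ _ hβ,
    ← Finset.add_sum_erase _ κ (Finset.mem_univ α), ← Finset.add_sum_erase _ κ hβ, ← add_assoc,
    ← add_assoc]
  congr 1
  · simp [hαβ]
    omega
  · refine Finset.sum_congr rfl fun δ hδ => ?_
    simp only [Finset.mem_erase] at hδ
    simp [hδ.1, hδ.2.1]

/-- The blocks in adjacent chambers are related by an `R`-matrix. -/
lemma block_eq_R_block (hq₁ : 1 < ‖P.q₁‖) (hγ : IsAdmissible P γ A)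
    (hreg : ∀ c, ∀ᵐ t ∂(volume.restrict (Set.Icc (0 : Fin k → ℝ) 1)),
      IsRegularPoint P A (γ.cube c t))
    (w : Equiv.Perm (Fin n)) {p q : Fin n} (hpq : (p : ℕ) + 1 = q) {α β : Fin n} (hα : w p = α)
    (hβ : w q = β)
    (hu : ∀ m : ℤ, spec A β / spec A α ≠ P.q₁ ^ m ∧ spec A β / spec A α ≠ P.K α * P.q₁ ^ m) :
    block P γ w A =
      P.R β α (spec A β / spec A α) (block P γ (w * Equiv.swap p q) A) := by
  have hαβ : α ≠ β := by
    rintro rfl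
    have := w.injective (hα.trans hβ.symm)
    rw [this] at hpq
    omega
  funext κ
  change _ = ∑ l : Fin (κ α + κ β + 1), _ * block P γ (w * Equiv.swap p q) A _
  have hsum := fun l : Fin (κ α + κ β + 1) =>
    sum_update_pair hαβ κ (Nat.lt_succ_iff.1 l.2)
  by_cases hκ : ∑ δ, κ δ = k
  · rw [block_of_sum_eq w hκ]
    simp only [fun l => block_of_sum_eq (P := P) (γ := γ) (A := A) (w * Equiv.swap p q)
      ((hsum l).trans hκ)]
    have hint : γ.integral (blockIntegrand P A w κ) = γ.integral fun lam =>
        ∑ l : Fin (κ α + κ β + 1),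
          Rmat P.q₁ (P.K α) (P.K β) (spec A β / spec A α) (κ α + κ β) ⟨κ α, by omega⟩ l *
          blockIntegrand P A (w * Equiv.swap p q)
            (Function.update (Function.update κ α (l : ℕ)) β (κ α + κ β - l)) lam := by
      refine γ.integral_congr fun c => ?_
      filter_upwards [hreg c] with t ht
      rw [blockIntegrand, stab_eq_sum_Rmat_mul_stab hpq hq₁ P.K (spec A) (spec_ne_zero A) hα hβ hu
        hκ ht.injective (vars_ne_zero _), Finset.sum_div, Finset.mul_sum]
      refine Finset.sum_congr rfl fun l _ => ?_
      rw [blockIntegrand]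
      ring
    rw [hint, Contour.integral_sum fun l _ =>
      (hγ.converges (w * Equiv.swap p q) ((hsum l).trans hκ)).const_mul _, Finset.mul_sum]
    refine Finset.sum_congr rfl fun l _ => ?_
    rw [Contour.integral_const_mul]
    ring
  · rw [block_of_sum_ne w hκ]
    refine (Finset.sum_eq_zero fun l _ => ?_).symm
    rw [block_of_sum_ne _ (by rw [hsum l]; exact hκ), mul_zero]

/-- Shifting `a_α` moves the first operator `α` of a chamber to the last position, at the cost of
`z ^ h_α`. -/
lemma block_shiftSpec {N : ℕ} {P : Params (N + 1)} {A : Fin (N + 1) → ℂ} (hq₂ : 1 < ‖P.q₂‖)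
    {α : Fin (N + 1)} (hγ : IsAdmissible P γ A) (hγ' : IsAdmissible P γ (shiftSpec P A α))
    (hreg : ∀ c, ∀ᵐ t ∂(volume.restrict (Set.Icc (0 : Fin k → ℝ) 1)),
      IsRegularPoint P A (γ.cube c t))
    {w₁ w₂ : Equiv.Perm (Fin (N + 1))} (h₁₀ : w₁ 0 = α)
    (h₁ : ∀ r : Fin N, w₁ r.succ = α.succAbove r) (h₂₀ : w₂ (Fin.last N) = α)
    (h₂ : ∀ r : Fin N, w₂ r.castSucc = α.succAbove r) :
    block P γ w₂ (shiftSpec P A α) = P.zPowWeight α (block P γ w₁ A) := by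
  have hlog : P.logq₂ ≠ 0 := by
    intro h
    rw [Params.q₂, h] at hq₂
    simp at hq₂
  funext κ
  change _ = Complex.exp (P.logz * (P.μ α / 2 - κ α)) * block P γ w₁ A κ
  by_cases hκ : ∑ β, κ β = k
  · have hc : κ α ≤ k := hκ ▸ Finset.single_le_sum (fun _ _ => Nat.zero_le _) (Finset.mem_univ α)
    have hint : γ.integral (blockIntegrand P (shiftSpec P A α) w₂ κ) =
        Complex.exp (-P.logz * κ α) * γ.integral (blockIntegrand P A w₁ κ) := by
      rw [hγ'.integral_eq_sum w₂ hκ, hγ.integral_eq_sum w₁ hκ, Finset.mul_sum,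
        ← Equiv.sum_comp (Equiv.mulRight (rotation k (κ α) hc))
          (fun σ => Complex.exp (-P.logz * κ α) * γ.integral (summand P A w₁ κ σ))]
      refine Finset.sum_congr rfl fun σ _ => ?_
      rw [← (hγ' w₂ κ hκ σ).2 ((initialSet k (κ α)).map σ.toEmbedding),
        ← Contour.integral_const_mul]
      refine γ.integral_congr fun c => ?_
      filter_upwards [hreg c] with t ht
      exact summand_shift P hq₂ h₁₀ h₁ h₂₀ h₂ hκ hc A σ ht
    have hpre : Complex.exp (P.s * ∑ β, P.μ β / 2 * shiftSpec P A α β) =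
        Complex.exp (P.logz * (P.μ α / 2)) * Complex.exp (P.s * ∑ β, P.μ β / 2 * A β) := by
      have h : ∑ β, P.μ β / 2 * shiftSpec P A α β =
          ∑ β, P.μ β / 2 * A β - P.μ α / 2 * P.logq₂ := by
        rw [← Finset.add_sum_erase _ _ (Finset.mem_univ α),
          ← Finset.add_sum_erase _ (fun β => P.μ β / 2 * A β) (Finset.mem_univ α)]
        have h' : ∑ β ∈ Finset.univ.erase α, P.μ β / 2 * shiftSpec P A α β =
            ∑ β ∈ Finset.univ.erase α, P.μ β / 2 * A β :=
          Finset.sum_congr rfl fun β hβ => by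
            rw [shiftSpec, Function.update_of_ne (Finset.ne_of_mem_erase hβ)]
        rw [h', shiftSpec, Function.update_self]
        ring
      rw [h, ← Complex.exp_add, Params.s]
      congr 1
      field_simp
      ring
    rw [block_of_sum_eq w₂ hκ, block_of_sum_eq w₁ hκ, hint, hpre,
      show P.logz * (P.μ α / 2 - κ α) = P.logz * (P.μ α / 2) + -P.logz * κ α by ring,
      Complex.exp_add]
    ring
  · rw [block_of_sum_ne w₂ hκ, block_of_sum_ne w₁ hκ, mul_zero]

end Chambers

/-! ### The chain of chambers -/

/-- The chamber in which `α` is moved to the position `j` and the other operators keep their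
order. -/
def insertChamber {N : ℕ} (α j : Fin (N + 1)) : Equiv.Perm (Fin (N + 1)) :=
  (finSuccEquiv' j).trans (finSuccEquiv' α).symm

section InsertChamber

variable {N : ℕ} (α : Fin (N + 1))

@[simp]
lemma insertChamber_apply_self (j : Fin (N + 1)) : insertChamber α j j = α := by
  simp [insertChamber]

@[simp]
lemma insertChamber_apply_succAbove (j : Fin (N + 1)) (r : Fin N) :
    insertChamber α j (j.succAbove r) = α.succAbove r := by
  simp [insertChamber]

lemma insertChamber_self : insertChamber α α = 1 := by
  simp [insertChamber, Equiv.Perm.one_def]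

lemma insertChamber_apply_succ (j : Fin N) :
    insertChamber α j.castSucc j.succ = α.succAbove j := by
  conv_lhs => rw [← Fin.succAbove_castSucc_self j]
  exact insertChamber_apply_succAbove α j.castSucc j

lemma insertChamber_apply_castSucc (j : Fin N) :
    insertChamber α j.succ j.castSucc = α.succAbove j := by
  conv_lhs => rw [← Fin.succAbove_succ_self j]
  exact insertChamber_apply_succAbove α j.succ j

lemma insertChamber_mul_swap (j : Fin N) :
    insertChamber α j.castSucc * Equiv.swap j.castSucc j.succ = insertChamber α j.succ := by
  ext1 i
  rw [Equiv.Perm.mul_apply]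
  rcases eq_or_ne i j.castSucc with rfl | hi
  · rw [Equiv.swap_apply_left, insertChamber_apply_succ, insertChamber_apply_castSucc]
  rcases eq_or_ne i j.succ with rfl | hi'
  · rw [Equiv.swap_apply_right, insertChamber_apply_self, insertChamber_apply_self]
  rw [Equiv.swap_apply_of_ne_of_ne hi hi']
  obtain ⟨r, rfl⟩ := Fin.exists_succAbove_eq hi'
  have hr : r ≠ j := by
    rintro rfl
    exact hi (Fin.succAbove_succ_self r)
  have h : j.succ.succAbove r = j.castSucc.succAbove r := by
    rcases lt_or_gt_of_ne hr with h | h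
    · rw [Fin.succAbove_of_castSucc_lt _ _ (Fin.castSucc_lt_castSucc_iff.2 h),
        Fin.succAbove_of_castSucc_lt _ _ ((Fin.castSucc_lt_castSucc_iff.2 h).trans
          Fin.castSucc_lt_succ)]
    · rw [Fin.succAbove_of_le_castSucc _ _ (Fin.castSucc_le_castSucc_iff.2 h.le),
        Fin.succAbove_of_le_castSucc _ _ (Fin.succ_le_castSucc_iff.2 h)]
  rw [insertChamber_apply_succAbove, h, insertChamber_apply_succAbove]

end InsertChamber

/-- A chain of relations between neighbouring vectors below `α` composes to an ordered product. -/
lemma prod_filter_lt_apply {E : Type*} [AddCommGroup E] [Module ℂ E] {N : ℕ}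
    (f : Fin (N + 1) → Module.End ℂ E) (V : Fin (N + 1) → E) (α : Fin (N + 1))
    (h : ∀ j : Fin N, j.castSucc < α → V j.castSucc = f j.castSucc (V j.succ)) :
    (((List.finRange (N + 1)).filter (fun β => β < α)).map f).prod (V α) = V 0 := by
  induction N with
  | zero =>
    obtain rfl : α = 0 := Fin.ext (by omega)
    simp
  | succ N ih =>
    induction α using Fin.cases with
    | zero => simp
    | succ α =>
      have := ih (fun j => f j.succ) (fun j => V j.succ) α fun j hj =>
        h j.succ (Fin.succ_lt_succ_iff.2 hj)
      rw [List.finRange_succ, List.filter_cons_of_pos (by simp), List.map_cons, List.prod_cons,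
        List.filter_map, List.map_map, Module.End.mul_apply]
      refine (congrArg (f 0) ?_).trans (h 0 (Fin.succ_pos α)).symm
      simpa [Function.comp_def] using this

/-- A chain of relations between neighbouring vectors above `α` composes to an ordered product. -/
lemma prod_filter_gt_apply {E : Type*} [AddCommGroup E] [Module ℂ E] {N : ℕ}
    (f : Fin (N + 1) → Module.End ℂ E) (V : Fin (N + 1) → E) (α : Fin (N + 1))
    (h : ∀ j : Fin N, α ≤ j.castSucc → V j.castSucc = f j.succ (V j.succ)) :
    (((List.finRange (N + 1)).filter (fun β => α < β)).map f).prod (V (Fin.last N)) = V α := by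
  induction N with
  | zero =>
    obtain rfl : α = 0 := Fin.ext (by omega)
    simp [List.finRange_succ]
  | succ N ih =>
    induction α using Fin.cases with
    | zero =>
      have := ih (fun j => f j.succ) (fun j => V j.succ) 0 fun j _ => h j.succ (Fin.zero_le _)
      rw [List.finRange_succ, List.filter_cons_of_neg (by simp),
        List.filter_eq_self.2 (by simp [Fin.pos_iff_ne_zero]), List.finRange_succ, List.map_map,
        List.map_cons, List.prod_cons, Module.End.mul_apply]
      rw [List.finRange_succ, List.filter_cons_of_neg (by simp),
        List.filter_eq_self.2 (by simp [Fin.pos_iff_ne_zero])] at this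
      exact (congrArg (f 1) this).trans (h 0 le_rfl).symm
    | succ α =>
      have := ih (fun j => f j.succ) (fun j => V j.succ) α fun j hj =>
        h j.succ (Fin.succ_le_succ_iff.2 hj)
      rw [List.finRange_succ, List.filter_cons_of_neg (by simp), List.filter_map, List.map_map]
      simpa [Function.comp_def] using this

lemma block_insertChamber {N k : ℕ} {P : Params (N + 1)} {γ : Contour k} {A : Fin (N + 1) → ℂ}
    (hq₁ : 1 < ‖P.q₁‖) (hγ : IsAdmissible P γ A)
    (hreg : ∀ c, ∀ᵐ t ∂(volume.restrict (Set.Icc (0 : Fin k → ℝ) 1)),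
      IsRegularPoint P A (γ.cube c t)) (α : Fin (N + 1)) (j : Fin N) {β : Fin (N + 1)}
    (hβ : α.succAbove j = β)
    (hu : ∀ m : ℤ, spec A β / spec A α ≠ P.q₁ ^ m ∧ spec A β / spec A α ≠ P.K α * P.q₁ ^ m) :
    block P γ (insertChamber α j.castSucc) A =
      P.R β α (spec A β / spec A α) (block P γ (insertChamber α j.succ) A) := by
  rw [← insertChamber_mul_swap]
  exact block_eq_R_block hq₁ hγ hreg _ (by simp) (insertChamber_apply_self α _)
    ((insertChamber_apply_succ α j).trans hβ) hu

end TrigQKZ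

end

theorem mainTheorem7 {n k : ℕ} (P : TrigQKZ.Params n) (hq₁ : 1 < ‖P.q₁‖) (hq₂ : 1 < ‖P.q₂‖)
    (A : Fin n → ℂ) (α : Fin n)
    (hlt : ∀ β < α, ∀ m : ℤ,
      TrigQKZ.spec A β / TrigQKZ.spec A α ≠ P.q₁ ^ m ∧
        TrigQKZ.spec A β / TrigQKZ.spec A α ≠ P.K α * P.q₁ ^ m)
    (hgt : ∀ β > α, ∀ m : ℤ,
      P.q₂ * TrigQKZ.spec A β / TrigQKZ.spec A α ≠ P.q₁ ^ m ∧
        P.q₂ * TrigQKZ.spec A β / TrigQKZ.spec A α ≠ P.K α * P.q₁ ^ m)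
    (γ : TrigQKZ.Contour k) (hpoles : TrigQKZ.AvoidsPoles P γ A)
    (hγ : TrigQKZ.IsAdmissible P γ A)
    (hγ' : TrigQKZ.IsAdmissible P γ (TrigQKZ.shiftSpec P A α)) :
    TrigQKZ.block P γ 1 (TrigQKZ.shiftSpec P A α) =
      ((((List.finRange n).filter (fun β => α < β)).map fun β =>
            P.R β α (P.q₂ * TrigQKZ.spec A β / TrigQKZ.spec A α)).prod *
          P.zPowWeight α *
          (((List.finRange n).filter (fun β => β < α)).map fun β =>
            P.R β α (TrigQKZ.spec A β / TrigQKZ.spec A α)).prod)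
        (TrigQKZ.block P γ 1 A) := by
  open TrigQKZ in
  obtain _ | N := n
  · exact α.elim0
  have hreg : ∀ c, ∀ᵐ t ∂(volume.restrict (Set.Icc (0 : Fin k → ℝ) 1)),
      IsRegularPoint P A (γ.cube c t) := hpoles
  have hreg' : ∀ c, ∀ᵐ t ∂(volume.restrict (Set.Icc (0 : Fin k → ℝ) 1)),
      IsRegularPoint P (shiftSpec P A α) (γ.cube c t) := fun c =>
    (hreg c).mono fun t ht => ht.shiftSpec α
  -- `α` moves from its place to the front, around the cycle, and from the end back to its place.
  have hlower := prod_filter_lt_apply (fun β => P.R β α (spec A β / spec A α))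
    (fun j => block P γ (insertChamber α j) A) α fun j hj =>
      block_insertChamber hq₁ hγ hreg α j (Fin.succAbove_of_castSucc_lt _ _ hj) (hlt _ hj)
  have hspec : ∀ β, α < β → spec (shiftSpec P A α) β / spec (shiftSpec P A α) α =
      P.q₂ * spec A β / spec A α := by
    intro β hβ
    rw [spec_shiftSpec, Function.update_of_ne hβ.ne', Function.update_self, div_div_eq_mul_div,
      mul_comm]
  have hupper := prod_filter_gt_apply (fun β => P.R β α (P.q₂ * spec A β / spec A α))
    (fun j => block P γ (insertChamber α j) (shiftSpec P A α)) α fun j hj => by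
      have hβ : α < j.succ := lt_of_le_of_lt hj Fin.castSucc_lt_succ
      have := block_insertChamber hq₁ hγ' hreg' α j (Fin.succAbove_of_le_castSucc _ _ hj)
        (by rw [hspec _ hβ]; exact hgt _ hβ)
      rwa [hspec _ hβ] at this
  have hcycle : block P γ (insertChamber α (Fin.last N)) (shiftSpec P A α) =
      P.zPowWeight α (block P γ (insertChamber α 0) A) := by
    refine block_shiftSpec hq₂ hγ hγ' hreg (insertChamber_apply_self α 0) (fun r => ?_)
      (insertChamber_apply_self α _) fun r => ?_
    · simpa using insertChamber_apply_succAbove α 0 r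
    · simpa using insertChamber_apply_succAbove α (Fin.last N) r
  simp only [insertChamber_self] at hlower hupper
  rw [Module.End.mul_apply, Module.End.mul_apply, hlower, ← hcycle, hupper]
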